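/- Let $a,d\in\mathbb N$. For each group $i=1,\dots,a$ let $\mathbf X_{i1},\mathbf X_{i2},\dots$ be i.i.d. random vectors in $\mathbb R^d$, $\mathbf X_{ik}=(X_{ijk})_{j=1}^d$, with an arbitrary law, the groups being independent of each other. The observed data $\mathbf X$ consist of $\mathbf X_{ik}$, $1\le k\le n_i$, $1\le i\le a$; put $N=\sum_{i=1}^a n_i$. The sample sizes vary in such a way that $N\to\infty$ and $n_i/N\to\lambda_i\in(0,1)$ for every $i$. Let $c(u)=\mathbf 1\{u>0\}+\frac12\mathbf 1\{u=0\}$, $\widehat F_{ij}(x)=\frac1{n_i}\sum_{k=1}^{n_i}c(x-X_{ijk})$, $\widehat G_j=\frac1a\sum_{\ell=1}^a\widehat F_{\ell j}$, $\widehat p_{ij}=\int\widehat G_j\,d\widehat F_{ij}=\frac1{n_i}\sum_{k=1}^{n_i}\widehat G_j(X_{ijk})$ and $\widehat{\mathbf p}=(\widehat p_{11},\widehat p_{12},\dots,\widehat p_{ad})'$. Let $\mathbf p^*$ be computed in the same way from a group-wise bootstrap sample: in each group $i$, given $\mathbf X$, the vectors $\mathbf X^*_{i1},\dots,\mathbf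 X^*_{in_i}$ are drawn independently and uniformly with replacement from $\mathbf X_{i1},\dots,\mathbf X_{in_i}$, independently across groups. For a symmetric idempotent matrix $\mathbf T\in\mathbb R^{ad\times ad}$ put $$T_N^*=N(\mathbf p^*-\widehat{\mathbf p})'\mathbf T(\mathbf p^*-\widehat{\mathbf p}).$$ Let $F_{ij}(x)=\frac12\big(P(X_{ij1}<x)+P(X_{ij1}\le x)\big)$, and let $\boldsymbol\Sigma$ be the $ad\times ad$ matrix with entries $\Sigma_{(i,j),(i',j')}=\frac1{a^2}\sum_{\ell=1}^a\sum_{\ell'=1}^a\sigma_{\ell ij,\ell'i'j'}$, where $$\begin{aligned}\sigma_{\ell ij,\ell'i'j'}={}&\tfrac{\delta_{\ell\ell'}}{\lambda_\ell}\operatorname{cov}\big(F_{ij}(X_{\ell j1}),F_{i'j'}(X_{\ell j'1})\big)-\tfrac{\delta_{\ell i'}}{\lambda_\ell}\operatorname{cov}\big(F_{ij}(X_{\ell j1}),F_{\ell'j'}(X_{\ell j'1})\big)\\&+\tfrac{\delta_{ii'}}{\lambda_i}\operatorname{cov}\big(F_{\ell j}(X_{ij1}),F_{\ell'j'}(X_{ij'1})\big)-\tfrac{\delta_{i\ell'}}{\lambda_i}\operatorname{cov}\big(F_{\ell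 j}(X_{ij1}),F_{i'j'}(X_{ij'1})\big).\end{aligned}$$ Then $\boldsymbol\Sigma$ is positive semidefinite, the eigenvalues $\nu_1,\dots,\nu_{ad}$ (with multiplicity) of $\boldsymbol\Sigma^{1/2}\mathbf T\boldsymbol\Sigma^{1/2}$ are nonnegative, and, with $\mathbf Z\sim N_{ad}(\mathbf 0,\boldsymbol\Sigma)$ and independent standard normal $Y_1,\dots,Y_{ad}$, the variables $\mathbf Z'\mathbf T\mathbf Z$ and $\sum_{h=1}^{ad}\nu_hY_h^2$ have the same law. Moreover, whether or not $\mathbf T\mathbf p=\mathbf 0$ for the vector $\mathbf p$ of the true effects $p_{ij}=\int\big(\frac1a\sum_{\ell=1}^aF_{\ell j}\big)\,dF_{ij}$, the statistic $T_N^*$ converges in distribution to $\sum_{h=1}^{ad}\nu_hY_h^2$ conditionally on $\mathbf X$ in outer probability, that is, $$\sup_{h}\big|E[h(T_N^*)\mid\mathbf X]-E\,h\big(\textstyle\sum_{r=1}^{ad}\nu_rY_r^2\big)\big|\longrightarrow0\quad\text{in outer probability},$$ where the supremum runs over all $h:\mathbb R\to\mathbb R$ with $|h|\le1$ and Lipschitz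 constant at most $1$. -/

import Mathlib

open MeasureTheory ProbabilityTheory Filter Topology Matrix
open scoped MatrixOrder

namespace MultiRank

noncomputable section

/-! ### Estimated effects -/

/-- The function `c(u) = 1{u > 0} + (1/2) 1{u = 0}`. -/
def c (u : ℝ) : ℝ := if 0 < u then 1 else if u = 0 then 1 / 2 else 0

/-- Realised data: for each of the `a` groups, `n i` vectors in `ℝ^d`;
`x i k j` is component `j` of individual `k` in group `i`. -/
abbrev Sample {a : ℕ} (n : Fin a → ℕ) (d : ℕ) : Type :=
  (i : Fin a) → Fin (n i) → Fin d → ℝ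

variable {a d : ℕ} {n : Fin a → ℕ}

/-- Normalized empirical distribution function of component `j` in group `i`. -/
def ecdf (x : Sample n d) (i : Fin a) (j : Fin d) (t : ℝ) : ℝ :=
  (∑ k, c (t - x i k j)) / (n i : ℝ)

/-- Unweighted mean over the groups of the empirical distribution functions. -/
def meanEcdf (x : Sample n d) (j : Fin d) (t : ℝ) : ℝ :=
  (∑ l, ecdf x l j t) / (a : ℝ)

/-- The vector of estimated effects. The entry at `(i, j)` is the integral of `meanEcdf x j`
with respect to the empirical distribution of component `j` in group `i`. -/
def estEffect (x : Sample n d) : Fin a × Fin d → ℝ :=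
  fun q => (∑ k, meanEcdf x q.2 (x q.1 k q.2)) / (n q.1 : ℝ)

/-! ### The group-wise bootstrap -/

/-- The data obtained by drawing in each group `i` the individuals with indices `κ i k`. Whole
`d`-dimensional vectors are drawn. -/
def resample (x : Sample n d) (κ : (i : Fin a) → Fin (n i) → Fin (n i)) : Sample n d :=
  fun i k => x i (κ i k)

/-- The law of the drawn indices: within group `i`, `n i` independent uniform draws from the
`n i` individuals of that group (with replacement), independently across groups. -/
def drawLaw (n : Fin a → ℕ) : Measure ((i : Fin a) → Fin (n i) → Fin (n i)) :=
  Measure.pi fun i => Measure.pi fun _ : Fin (n i) => uniformOn (Set.univ : Set (Fin (n i)))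

/-- The bootstrap ANOVA-type statistic `N (p* - p̂)' T (p* - p̂)`, as a function of the
data `x` and of the drawn indices `κ`. -/
def bootATS (T : Matrix (Fin a × Fin d) (Fin a × Fin d) ℝ) (x : Sample n d)
    (κ : (i : Fin a) → Fin (n i) → Fin (n i)) : ℝ :=
  ((∑ i, n i : ℕ) : ℝ) *
    ((estEffect (resample x κ) - estEffect x) ⬝ᵥ
      (T *ᵥ (estEffect (resample x κ) - estEffect x)))

/-- The conditional law of the bootstrap ANOVA-type statistic given that the data are `x`. -/
def bootATSLaw (T : Matrix (Fin a × Fin d) (Fin a × Fin d) ℝ) (x : Sample n d) : Measure ℝ :=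
  (drawLaw n).map (bootATS T x)

instance isProbabilityMeasure_drawLaw (n : Fin a → ℕ) : IsProbabilityMeasure (drawLaw n) := by
  have h : ∀ i : Fin a, ∀ _ : Fin (n i),
      IsProbabilityMeasure (uniformOn (Set.univ : Set (Fin (n i)))) := by
    intro i k
    have : Nonempty (Fin (n i)) := ⟨k⟩
    infer_instance
  have h' : ∀ i : Fin a, IsProbabilityMeasure
      (Measure.pi fun _ : Fin (n i) => uniformOn (Set.univ : Set (Fin (n i)))) := by
    intro i
    have := h i
    infer_instance
  unfold drawLaw
  infer_instance

instance isProbabilityMeasure_bootATSLaw (T : Matrix (Fin a × Fin d) (Fin a × Fin d) ℝ)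
    (x : Sample n d) : IsProbabilityMeasure (bootATSLaw T x) :=
  Measure.isProbabilityMeasure_map (measurable_of_finite _).aemeasurable

/-! ### Conditional convergence in distribution in outer probability -/

/-- The bounded Lipschitz distance of two laws on the real line: the supremum of
`|∫ h dμ - ∫ h dν|` over all `h` with `|h| ≤ 1` and Lipschitz constant at most `1`. -/
def blDist (μ ν : Measure ℝ) : ℝ :=
  ⨆ h : {h : ℝ → ℝ // LipschitzWith 1 h ∧ ∀ x, |h x| ≤ 1},
    |(∫ x, h.1 x ∂μ) - ∫ x, h.1 x ∂ν|

/-- For probability measures the supremum in `blDist` is over a bounded family. -/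
theorem bddAbove_blDist (μ ν : Measure ℝ) [IsProbabilityMeasure μ] [IsProbabilityMeasure ν] :
    BddAbove (Set.range fun h : {h : ℝ → ℝ // LipschitzWith 1 h ∧ ∀ x, |h x| ≤ 1} =>
      |(∫ x, h.1 x ∂μ) - ∫ x, h.1 x ∂ν|) := by
  refine ⟨2, ?_⟩
  rintro _ ⟨h, rfl⟩
  have key : ∀ ρ : Measure ℝ, IsProbabilityMeasure ρ → |∫ x, h.1 x ∂ρ| ≤ 1 := by
    intro ρ hρ
    have := norm_integral_le_of_norm_le_const (μ := ρ) (f := h.1) (C := 1)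
      (Eventually.of_forall fun x => by simpa using h.2.2 x)
    simpa using this
  have h1 := abs_le.1 (key μ inferInstance)
  have h2 := abs_le.1 (key ν inferInstance)
  exact abs_le.2 ⟨by linarith [h1.1, h2.2], by linarith [h1.2, h2.1]⟩

/-- Random laws `L m ω` on the real line converge weakly to the law `ν` in outer `P`-probability.
(A measure applied to a set that is not measurable is its outer measure.) -/
def TendstoInOuterProb {Ω : Type*} [MeasurableSpace Ω] (P : Measure Ω)
    (L : ℕ → Ω → Measure ℝ) (ν : Measure ℝ) : Prop :=
  ∀ ε : ℝ, 0 < ε → Tendsto (fun m => P {ω | ε < blDist (L m ω) ν}) atTop (𝓝 0)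

/-! ### The asymptotic covariance matrix and the limit laws

Here `μ i` is the law on `ℝ^d` of one observation in group `i` and `lam i` is the limiting
fraction of the observations that belong to group `i`. -/

/-- Normalized distribution function: the mean of the left- and right-continuous versions. -/
def normCDF (ρ : Measure ℝ) (t : ℝ) : ℝ := (ρ.real (Set.Iio t) + ρ.real (Set.Iic t)) / 2

/-- The normalized distribution function of component `j` in group `i`. -/
def groupCDF (μ : Fin a → Measure (Fin d → ℝ)) (i : Fin a) (j : Fin d) : ℝ → ℝ :=
  normCDF ((μ i).map fun y => y j)

/-- `cov(F_{i j}(X_{l j 1}), F_{i' j'}(X_{l j' 1}))`. -/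
def covF (μ : Fin a → Measure (Fin d → ℝ)) (l i i' : Fin a) (j j' : Fin d) : ℝ :=
  cov[fun y => groupCDF μ i j (y j), fun y => groupCDF μ i' j' (y j'); μ l]

/-- The limit of `N cov(ŵ_{l i j}, ŵ_{l' i' j'})`, where `ŵ_{l i j}` is the estimator of the
pairwise effect `w_{l i j} = ∫ F_{l j} dF_{i j}`. -/
def covW (μ : Fin a → Measure (Fin d → ℝ)) (lam : Fin a → ℝ)
    (l i : Fin a) (j : Fin d) (l' i' : Fin a) (j' : Fin d) : ℝ :=
  (if l = l' then (lam l)⁻¹ * covF μ l i i' j j' else 0)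
    - (if l = i' then (lam l)⁻¹ * covF μ l i l' j j' else 0)
    + (if i = i' then (lam i)⁻¹ * covF μ i l l' j j' else 0)
    - (if i = l' then (lam i)⁻¹ * covF μ i l i' j j' else 0)

/-- The asymptotic covariance matrix `Σ` of the estimated effects, obtained from `covW` since each
estimated effect is the mean of the pairwise ones. -/
def asympCov (μ : Fin a → Measure (Fin d → ℝ)) (lam : Fin a → ℝ) :
    Matrix (Fin a × Fin d) (Fin a × Fin d) ℝ :=
  Matrix.of fun q q' =>
    (1 / (a : ℝ) ^ 2) * ∑ l, ∑ l', covW μ lam l q.1 q.2 l' q'.1 q'.2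

theorem isHermitian_sqrt_mul_mul_sqrt {ι : Type*} [Fintype ι] [DecidableEq ι]
    (S : Matrix ι ι ℝ) {T : Matrix ι ι ℝ} (hT : T.IsSymm) :
    (CFC.sqrt S * T * CFC.sqrt S).IsHermitian := by
  have h1 : (CFC.sqrt S).IsHermitian := (CFC.sqrt_nonneg S).posSemidef.1
  have h2 : Tᴴ = T := by rw [conjTranspose_eq_transpose_of_trivial]; exact hT
  unfold Matrix.IsHermitian
  rw [conjTranspose_mul, conjTranspose_mul, h1.eq, h2, Matrix.mul_assoc]

/-- The eigenvalues (with multiplicity) of `S^{1/2} T S^{1/2}` for symmetric `T`. -/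
def weights {ι : Type*} [Fintype ι] [DecidableEq ι]
    (S : Matrix ι ι ℝ) {T : Matrix ι ι ℝ} (hT : T.IsSymm) : ι → ℝ :=
  (isHermitian_sqrt_mul_mul_sqrt S hT).eigenvalues

/-- The law of `Z' T Z` with `Z ∼ N(0, S)`. -/
def gaussianFormLaw {ι : Type*} [Fintype ι] [DecidableEq ι] (S T : Matrix ι ι ℝ) : Measure ℝ :=
  (multivariateGaussian (0 : EuclideanSpace ℝ ι) S).map
    fun z => z.ofLp ⬝ᵥ (T *ᵥ z.ofLp)

/-- The law of `∑ h, ν h * (Y h) ^ 2` with independent standard normal `Y h`. -/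
def weightedChiSqLaw {ι : Type*} [Fintype ι] (ν : ι → ℝ) : Measure ℝ :=
  (Measure.pi fun _ : ι => gaussianReal 0 1).map fun y => ∑ h, ν h * y h ^ 2

end

end MultiRank

namespace MultiRank

/-! ### Gaussian quadratic forms. -/

section
-- The bootstrap law is a function of the sample alone, so the core of the proof is a deterministic
-- statement about sequences of samples; probability enters only to show that typical samples are
-- good.
--
-- For a fixed sample, p* - p̂ is a difference of double averages and splits exactly
-- (`estEffect_resample_sub`) into a linear part, a sum over the groups of bootstrap deviations of
-- empirical scores, and a bilinear part `bootRem`. The bilinear part vanishes if both resamples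
-- belong to one group, since c(-u) = 1 - c(u); otherwise its second moment is at most 1/(n_i n_l),
-- so it is negligible even after multiplication by √N. The linear part consists of independent
-- averages of bounded i.i.d. draws, and a Taylor expansion of characteristic functions
-- (`tendsto_integral_exp_bootDev`) gives a Gaussian limit as soon as the empirical variances of the
-- scores converge. The covariance of the limit is Σ because Σ is the sum over l of 1/λ_l times the
-- covariance matrix of the scores in group l (`asympCov_apply_eq_sum`), which also shows that Σ is
-- positive semidefinite. Lévy continuity and continuous mapping give the limit law of Z'TZ, and
-- diagonalising Σ^{1/2} T Σ^{1/2} turns it into a weighted sum of chi-squares. Since p* is centred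
-- at p̂, the value of Tp never enters.
--
-- What is required of the samples is condensed into one number, `empErr`, whose mean tends to zero
-- by second-moment bounds (`tendsto_integral_empErr`). A contradiction argument
-- (`exists_blDist_le_of_empErr_lt`) upgrades the sequential limit to: small `empErr` forces small
-- bounded Lipschitz distance, eventually and uniformly in the sample. Markov's inequality then
-- finishes the proof.
theorem weights_nonneg {ι : Type*} [Fintype ι] [DecidableEq ι] (S : Matrix ι ι ℝ)
    {T : Matrix ι ι ℝ} (hT : T.IsSymm) (hT' : T * T = T) (h : ι) : 0 ≤ weights S hT h := by
  have h1 : (CFC.sqrt S).IsHermitian := (CFC.sqrt_nonneg S).posSemidef.1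
  have h2 : Tᴴ = T := by rw [conjTranspose_eq_transpose_of_trivial]; exact hT
  -- A symmetric idempotent equals `Tᴴ * T`; congruence by the symmetric square root of `S` keeps it
  -- positive semidefinite.
  have hpsd : T.PosSemidef := by
    have := posSemidef_conjTranspose_mul_self T
    rwa [h2, hT'] at this
  have h3 := hpsd.mul_mul_conjTranspose_same (CFC.sqrt S)
  rw [h1.eq] at h3
  exact h3.eigenvalues_nonneg h

/-- A Gaussian quadratic form is distributed as a weighted sum of independent chi-squares. -/
theorem gaussianFormLaw_eq_weightedChiSqLaw {ι : Type*} [Fintype ι] [DecidableEq ι]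
    (S : Matrix ι ι ℝ) {T : Matrix ι ι ℝ} (hT : T.IsSymm) :
    gaussianFormLaw S T = weightedChiSqLaw (weights S hT) := by
  have hM := isHermitian_sqrt_mul_mul_sqrt S hT
  have h1 : (CFC.sqrt S)ᵀ = CFC.sqrt S := by
    have : (CFC.sqrt S).IsHermitian := (CFC.sqrt_nonneg S).posSemidef.1
    rw [← conjTranspose_eq_transpose_of_trivial]; exact this
  have hq : Measurable fun z : EuclideanSpace ℝ ι => z.ofLp ⬝ᵥ (T *ᵥ z.ofLp) := by
    apply Continuous.measurable
    simp only [dotProduct, mulVec]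
    fun_prop
  unfold gaussianFormLaw weightedChiSqLaw multivariateGaussian
  -- The standard Gaussian has i.i.d. coordinates in every orthonormal basis; in the eigenbasis of
  -- S^{1/2} T S^{1/2} the form becomes diagonal.
  rw [stdGaussian_eq_map_pi_orthonormalBasis hM.eigenvectorBasis, Measure.map_map (by fun_prop)
    (by fun_prop), Measure.map_map (hq.comp (by fun_prop)) (by fun_prop)]
  congr 1
  funext y
  set z : EuclideanSpace ℝ ι := ∑ i, y i • hM.eigenvectorBasis i with hz
  have hMz : (CFC.sqrt S * T * CFC.sqrt S) *ᵥ z.ofLp =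
      ∑ i, (y i * weights S hT i) • (hM.eigenvectorBasis i).ofLp := by
    rw [hz]
    simp only [WithLp.ofLp_sum, WithLp.ofLp_smul, mulVec_sum, mulVec_smul,
      hM.mulVec_eigenvectorBasis, smul_smul]
    rfl
  have e1 : z.ofLp ⬝ᵥ ((CFC.sqrt S * T * CFC.sqrt S) *ᵥ z.ofLp)
      = ∑ h, weights S hT h * y h ^ 2 := by
    have e2 : z.ofLp ⬝ᵥ ((CFC.sqrt S * T * CFC.sqrt S) *ᵥ z.ofLp)
      = inner ℝ (∑ i, (y i * weights S hT i) • hM.eigenvectorBasis i) z := by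
      rw [EuclideanSpace.inner_eq_star_dotProduct, hMz]
      simp
    rw [e2, hz, hM.eigenvectorBasis.orthonormal.inner_sum]
    refine Finset.sum_congr rfl fun i _ => ?_
    simp
    ring
  simp only [Function.comp, zero_add]
  rw [← e1, ofLp_toEuclideanCLM, ← mulVec_mulVec, ← mulVec_mulVec,
    dotProduct_mulVec z.ofLp (CFC.sqrt S), ← mulVec_transpose, h1]

/-! ### Weak convergence and the bounded Lipschitz distance. -/

/-- For Lipschitz test functions, a bound of the Lévy-Prokhorov distance bounds the difference of
the integrals. -/
theorem integral_le_of_levyProkhorovEDist_lt_of_lipschitz (μ ν : Measure ℝ)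
    [IsProbabilityMeasure μ] [IsProbabilityMeasure ν] {ε : ℝ} (hε : 0 < ε)
    (h : levyProkhorovEDist μ ν < ENNReal.ofReal ε) {f : ℝ → ℝ} (hf : LipschitzWith 1 f)
    (hf1 : ∀ x, |f x| ≤ 1) : ∫ x, f x ∂μ ≤ ∫ x, f x ∂ν + 3 * ε + ε ^ 2 := by
  have hb : ∀ x, ‖1 + f x‖ ≤ 2 := fun x => by
    have := abs_le.1 (hf1 x)
    rw [Real.norm_eq_abs, abs_le]; constructor <;> linarith
  have hbe : ∀ x, ‖1 + f x + ε‖ ≤ 2 + ε := fun x => by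
    have := abs_le.1 (hf1 x)
    rw [Real.norm_eq_abs, abs_le]; constructor <;> linarith
  have hc : Continuous fun x => 1 + f x := by have := hf.continuous; fun_prop
  have hce : Continuous fun x => 1 + f x + ε := by fun_prop
  -- Adding 1 makes the test function nonnegative, so that the layer-cake formula applies. The
  -- further shift by `ε` in `ge` absorbs the thickening of level sets, because `f` moves by at most
  -- `ε` over a distance `ε`.
  let g : BoundedContinuousFunction ℝ ℝ := BoundedContinuousFunction.ofNormedAddCommGroup _ hc 2 hb
  let ge : BoundedContinuousFunction ℝ ℝ :=
    BoundedContinuousFunction.ofNormedAddCommGroup _ hce (2 + ε) hbe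
  have hg0 : ∀ x, 0 ≤ g x := fun x => by
    have := abs_le.1 (hf1 x)
    change 0 ≤ 1 + f x
    linarith
  have hge0 : ∀ x, 0 ≤ ge x := fun x => by
    have := hg0 x
    change 0 ≤ 1 + f x at this
    change 0 ≤ 1 + f x + ε
    linarith
  have hgn : ‖g‖ ≤ 2 := BoundedContinuousFunction.norm_ofNormedAddCommGroup_le _ (by norm_num) _
  have hgle : ‖g‖ ≤ ‖ge‖ := by
    refine (BoundedContinuousFunction.norm_le (norm_nonneg _)).2 fun x => ?_
    refine le_trans ?_ (ge.norm_coe_le_norm x)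
    rw [Real.norm_of_nonneg (hg0 x), Real.norm_of_nonneg (hge0 x)]
    change 1 + f x ≤ 1 + f x + ε
    linarith
  have hmeas : ∀ s : ℝ → Set ℝ, Antitone s → ∀ M : ℝ,
      IntegrableOn (fun t => ν.real (s t)) (Set.Ioc 0 M) := by
    intro s hs M
    apply Measure.integrableOn_of_bounded (M := ν.real Set.univ) measure_Ioc_lt_top.ne
    · apply (Measurable.ennreal_toReal (Antitone.measurable ?_)).aestronglyMeasurable
      exact fun _ _ hst => measure_mono (hs hst)
    · refine Eventually.of_forall fun t => ?_
      simp only [Real.norm_eq_abs, abs_of_nonneg measureReal_nonneg]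
      exact measureReal_mono (Set.subset_univ _)
  have i2 : IntegrableOn (fun t => ν.real {x | t ≤ ge x}) (Set.Ioc 0 ‖ge‖) :=
    hmeas (fun t => {x | t ≤ ge x}) (fun _ _ hst _ hx => le_trans hst hx) _
  have k1 := BoundedContinuousFunction.integral_le_of_levyProkhorovEDist_lt μ ν hε h g
    (Eventually.of_forall hg0)
  have k2 : ∫ t in Set.Ioc 0 ‖g‖, ν.real (Metric.thickening ε {x | t ≤ g x}) ≤
      ∫ x, ge x ∂ν := by
    rw [BoundedContinuousFunction.integral_eq_integral_meas_le ge ν (Eventually.of_forall hge0)]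
    calc ∫ t in Set.Ioc 0 ‖g‖, ν.real (Metric.thickening ε {x | t ≤ g x})
        ≤ ∫ t in Set.Ioc 0 ‖g‖, ν.real {x | t ≤ ge x} := by
          refine setIntegral_mono ?_ (i2.mono_set (Set.Ioc_subset_Ioc_right hgle)) fun t => ?_
          · exact hmeas (fun t => Metric.thickening ε {x | t ≤ g x}) (fun _ _ hst =>
              Metric.thickening_subset_of_subset ε fun _ hx => le_trans hst hx) _
          · refine measureReal_mono fun x hx => ?_
            obtain ⟨y, hy, hxy⟩ := Metric.mem_thickening_iff.1 hx
            change t ≤ 1 + f y at hy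
            change t ≤ 1 + f x + ε
            have := hf.dist_le_mul y x
            rw [Real.dist_eq, dist_comm] at this
            have := (abs_le.1 this).2
            simp at this
            linarith
      _ ≤ ∫ t in Set.Ioc 0 ‖ge‖, ν.real {x | t ≤ ge x} :=
          setIntegral_mono_set i2 (Eventually.of_forall fun t => measureReal_nonneg)
            (Set.Ioc_subset_Ioc_right hgle).eventuallyLE
  have hfi : ∀ ρ : Measure ℝ, IsProbabilityMeasure ρ → Integrable f ρ := fun ρ _ =>
    Integrable.of_bound hf.continuous.aestronglyMeasurable 1
      (Eventually.of_forall fun x => by simpa using hf1 x)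
  have e1 : ∫ x, g x ∂μ = 1 + ∫ x, f x ∂μ := by
    change ∫ x, (1 + f x) ∂μ = _
    rw [integral_add (integrable_const _) (hfi _ inferInstance)]; simp
  have e2 : ∫ x, ge x ∂ν = 1 + ∫ x, f x ∂ν + ε := by
    change ∫ x, (1 + f x + ε) ∂ν = _
    rw [integral_add (f := fun x => 1 + f x)
      ((integrable_const _).add (hfi _ inferInstance)) (integrable_const _),
      integral_add (integrable_const _) (hfi _ inferInstance)]; simp
  -- One `ε` comes from the shift in `ge` and two from this term; `ε ^ 2` is slack.
  have : ε * ‖g‖ ≤ ε * 2 := by gcongr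
  nlinarith [sq_nonneg ε]

/-- Weak convergence implies convergence in the bounded Lipschitz distance. -/
theorem tendsto_blDist {L : ℕ → ProbabilityMeasure ℝ} {ν : ProbabilityMeasure ℝ}
    (h : Tendsto L atTop (𝓝 ν)) :
    Tendsto (fun m => blDist (L m) ν) atTop (𝓝 0) := by
  have h1 : Tendsto (fun m => edist (LevyProkhorov.ofMeasure (L m)) (LevyProkhorov.ofMeasure ν))
      atTop (𝓝 0) :=
    tendsto_iff_edist_tendsto_0.1
      ((LevyProkhorov.continuous_ofMeasure_probabilityMeasure.tendsto ν).comp h)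
  have h0 : ∀ m, 0 ≤ blDist (L m) ν := fun m => Real.iSup_nonneg fun _ => abs_nonneg _
  rw [Metric.tendsto_atTop]
  intro δ hδ
  obtain ⟨ε, hε, hεδ⟩ : ∃ ε : ℝ, 0 < ε ∧ 3 * ε + ε ^ 2 < δ := by
    -- With `ε ≤ 1` the sum is at most `4 * ε`, which is less than `5 * ε ≤ δ`.
    refine ⟨min 1 (δ / 5), by positivity, ?_⟩
    have a1 := min_le_left 1 (δ / 5)
    have a2 := min_le_right 1 (δ / 5)
    have a3 : 0 < min 1 (δ / 5) := by positivity
    nlinarith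
  obtain ⟨M, hM⟩ := eventually_atTop.1 (h1.eventually_lt_const (ENNReal.ofReal_pos.2 hε))
  refine ⟨M, fun m hm => ?_⟩
  have hlt : levyProkhorovEDist (L m : Measure ℝ) ν < ENNReal.ofReal ε := hM m hm
  have hlt' : levyProkhorovEDist (ν : Measure ℝ) (L m) < ENNReal.ofReal ε := by
    rwa [levyProkhorovEDist_comm]
  rw [Real.dist_eq, sub_zero, abs_of_nonneg (h0 m)]
  refine lt_of_le_of_lt ?_ hεδ
  have : Nonempty {h : ℝ → ℝ // LipschitzWith 1 h ∧ ∀ x, |h x| ≤ 1} :=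
    ⟨⟨fun _ => 0, LipschitzWith.const' 0, by simp⟩⟩
  refine ciSup_le fun f => ?_
  have a1 := integral_le_of_levyProkhorovEDist_lt_of_lipschitz _ _ hε hlt f.2.1 f.2.2
  have a2 := integral_le_of_levyProkhorovEDist_lt_of_lipschitz _ _ hε hlt' f.2.1 f.2.2
  rw [abs_le]
  constructor <;> linarith

end

section
variable {a d : ℕ}

/-! ### Distribution functions -/

theorem c_nonneg (u : ℝ) : 0 ≤ c u := by
  unfold c; split_ifs <;> norm_num

theorem c_le_one (u : ℝ) : c u ≤ 1 := by
  unfold c; split_ifs <;> norm_num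

theorem abs_c_le_one (u : ℝ) : |c u| ≤ 1 := abs_le.2 ⟨by linarith [c_nonneg u], c_le_one u⟩

/-- The value 1/2 at ties makes this hold at 0 too. This antisymmetry up to a constant is what makes
within-group terms cancel. -/
theorem c_neg (u : ℝ) : c (-u) = 1 - c u := by
  unfold c
  rcases lt_trichotomy u 0 with h | h | h
  · rw [if_pos (by linarith), if_neg (by linarith), if_neg (by linarith)]; norm_num
  · subst h; norm_num
  · rw [if_neg (by linarith), if_neg (by linarith), if_pos h]; norm_num

theorem measurable_c : Measurable c :=
  Measurable.ite measurableSet_Ioi measurable_const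
    (Measurable.ite (measurableSet_singleton 0) measurable_const measurable_const)

theorem normCDF_nonneg (ρ : Measure ℝ) (t : ℝ) : 0 ≤ normCDF ρ t := by
  unfold normCDF
  have := measureReal_nonneg (μ := ρ) (s := Set.Iio t)
  have := measureReal_nonneg (μ := ρ) (s := Set.Iic t)
  linarith

theorem normCDF_le_one (ρ : Measure ℝ) [IsProbabilityMeasure ρ] (t : ℝ) : normCDF ρ t ≤ 1 := by
  unfold normCDF
  have := measureReal_le_one (μ := ρ) (s := Set.Iio t)
  have := measureReal_le_one (μ := ρ) (s := Set.Iic t)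
  linarith

theorem measurable_normCDF (ρ : Measure ℝ) [IsProbabilityMeasure ρ] : Measurable (normCDF ρ) := by
  refine Monotone.measurable fun s t hst => ?_
  unfold normCDF
  have := measureReal_mono (μ := ρ) (Set.Iio_subset_Iio hst)
  have := measureReal_mono (μ := ρ) (Set.Iic_subset_Iic.2 hst)
  linarith

theorem integral_c_sub (ρ : Measure ℝ) [IsProbabilityMeasure ρ] (t : ℝ) :
    ∫ s, c (t - s) ∂ρ = normCDF ρ t := by
  have h : ∀ s, c (t - s) =
      ((Set.Iio t).indicator 1 s + (Set.Iic t).indicator 1 s) / 2 := by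
    intro s
    unfold c
    simp only [Set.indicator, Set.mem_Iio, Set.mem_Iic, Pi.one_apply]
    rcases lt_trichotomy s t with h | h | h
    · rw [if_pos (by linarith), if_pos h, if_pos h.le]; norm_num
    · subst h; simp
    · rw [if_neg (by linarith), if_neg (by linarith), if_neg (by linarith), if_neg (by linarith)]
      norm_num
  simp_rw [h]
  rw [integral_div, integral_add, integral_indicator_one measurableSet_Iio,
    integral_indicator_one measurableSet_Iic]
  · rfl
  · exact (integrable_const (1 : ℝ)).indicator measurableSet_Iio
  · exact (integrable_const (1 : ℝ)).indicator measurableSet_Iic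

theorem groupCDF_nonneg (μ : Fin a → Measure (Fin d → ℝ)) (i : Fin a) (j : Fin d) (t : ℝ) :
    0 ≤ groupCDF μ i j t :=
  normCDF_nonneg _ _

section groupCDF

variable (μ : Fin a → Measure (Fin d → ℝ)) [∀ i, IsProbabilityMeasure (μ i)]

instance isProbabilityMeasure_map_eval (i : Fin a) (j : Fin d) :
    IsProbabilityMeasure ((μ i).map fun y => y j) :=
  Measure.isProbabilityMeasure_map (measurable_pi_apply j).aemeasurable

theorem groupCDF_le_one (i : Fin a) (j : Fin d) (t : ℝ) : groupCDF μ i j t ≤ 1 :=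
  normCDF_le_one _ _

@[fun_prop]
theorem measurable_groupCDF (i : Fin a) (j : Fin d) : Measurable (groupCDF μ i j) :=
  measurable_normCDF _

theorem integral_c_sub_apply (i : Fin a) (j : Fin d) (t : ℝ) :
    ∫ z, c (t - z j) ∂(μ i) = groupCDF μ i j t := by
  have hc := measurable_c
  rw [groupCDF, ← integral_c_sub, integral_map (measurable_pi_apply j).aemeasurable]
  exact (hc.comp (by fun_prop)).aestronglyMeasurable

end groupCDF

theorem memLp_two_of_bound {α : Type*} [MeasurableSpace α] {ρ : Measure α} [IsFiniteMeasure ρ]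
    {f : α → ℝ} (hf : Measurable f) {B : ℝ} (hB : ∀ y, |f y| ≤ B) : MemLp f 2 ρ :=
  MemLp.of_bound hf.aestronglyMeasurable B (Eventually.of_forall hB)

theorem integrable_of_bound {α : Type*} [MeasurableSpace α] {ρ : Measure α} [IsFiniteMeasure ρ]
    {f : α → ℝ} (hf : Measurable f) {B : ℝ} (hB : ∀ y, |f y| ≤ B) : Integrable f ρ :=
  Integrable.of_bound hf.aestronglyMeasurable B (Eventually.of_forall hB)

/-! ### Scores

The estimated effect at `(i, j)` is asymptotically the sum over the groups `l` of the means of the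
scores `score F l (i, j)` of the observations in group `l`. -/

/-- The score at `q = (i, j)` of an observation `y` in group `l`, for distribution functions
`F`. -/
noncomputable def score (F : Fin a → Fin d → ℝ → ℝ) (l : Fin a) (q : Fin a × Fin d)
    (y : Fin d → ℝ) : ℝ :=
  (if q.1 = l then 1 else 0) * ((a : ℝ)⁻¹ * ∑ k, F k q.2 (y q.2)) -
    (a : ℝ)⁻¹ * F q.1 q.2 (y q.2)

/-- Allows empirical distribution functions to be exchanged for the true ones inside scores. The
factor 2 counts the two terms of `score`, each bounded by the sum because `a⁻¹ ≤ 1`. -/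
theorem abs_score_sub_score_le (F F' : Fin a → Fin d → ℝ → ℝ) (l : Fin a) (q : Fin a × Fin d)
    (y : Fin d → ℝ) :
    |score F l q y - score F' l q y| ≤ 2 * ∑ k, |F k q.2 (y q.2) - F' k q.2 (y q.2)| := by
  have ha : (0 : ℝ) < a := by
    have : 0 < a := Fin.pos l
    exact_mod_cast this
  have ha1 : (a : ℝ)⁻¹ ≤ 1 := by
    have : 0 < a := Fin.pos l
    exact inv_le_one_of_one_le₀ (by exact_mod_cast this)
  have e : score F l q y - score F' l q y =
      (if q.1 = l then 1 else 0) * ((a : ℝ)⁻¹ * ∑ k, (F k q.2 (y q.2) - F' k q.2 (y q.2))) -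
      (a : ℝ)⁻¹ * (F q.1 q.2 (y q.2) - F' q.1 q.2 (y q.2)) := by
    unfold score
    rw [Finset.sum_sub_distrib]
    ring
  set S := ∑ k, |F k q.2 (y q.2) - F' k q.2 (y q.2)|
  have hS : 0 ≤ S := Finset.sum_nonneg fun _ _ => abs_nonneg _
  have h1 : |(a : ℝ)⁻¹ * ∑ k, (F k q.2 (y q.2) - F' k q.2 (y q.2))| ≤ S := by
    rw [abs_mul, abs_of_pos (inv_pos.2 ha)]
    calc _ ≤ 1 * S := mul_le_mul ha1 (Finset.abs_sum_le_sum_abs _ _) (abs_nonneg _) zero_le_one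
      _ = S := one_mul _
  have h2 : |(a : ℝ)⁻¹ * (F q.1 q.2 (y q.2) - F' q.1 q.2 (y q.2))| ≤ S := by
    rw [abs_mul, abs_of_pos (inv_pos.2 ha)]
    calc _ ≤ 1 * S := mul_le_mul ha1 (Finset.single_le_sum
            (f := fun k => |F k q.2 (y q.2) - F' k q.2 (y q.2)|)
            (fun _ _ => abs_nonneg _) (Finset.mem_univ q.1)) (abs_nonneg _) zero_le_one
      _ = S := one_mul _
  rw [e]
  refine (abs_sub _ _).trans ?_
  rw [two_mul]
  refine add_le_add ?_ h2
  split_ifs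
  · simpa using h1
  · simpa using hS

theorem abs_score_le_one {F : Fin a → Fin d → ℝ → ℝ} (h0 : ∀ i j t, 0 ≤ F i j t)
    (h1 : ∀ i j t, F i j t ≤ 1) (l : Fin a) (q : Fin a × Fin d) (y : Fin d → ℝ) :
    |score F l q y| ≤ 1 := by
  have ha : (0 : ℝ) < a := by
    have : 0 < a := Fin.pos l
    exact_mod_cast this
  have ha1 : (a : ℝ)⁻¹ ≤ 1 := by
    have : 0 < a := Fin.pos l
    exact inv_le_one_of_one_le₀ (by exact_mod_cast this)
  have k1 : (a : ℝ)⁻¹ * ∑ k, F k q.2 (y q.2) ≤ 1 := by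
    calc (a : ℝ)⁻¹ * ∑ k, F k q.2 (y q.2) ≤ (a : ℝ)⁻¹ * ∑ _k : Fin a, 1 := by
          gcongr with k; exact h1 _ _ _
      _ = 1 := by simp [ha.ne']
  have k0 : 0 ≤ (a : ℝ)⁻¹ * ∑ k, F k q.2 (y q.2) :=
    mul_nonneg (inv_nonneg.2 ha.le) (Finset.sum_nonneg fun _ _ => h0 _ _ _)
  have k2 : 0 ≤ (a : ℝ)⁻¹ * F q.1 q.2 (y q.2) := mul_nonneg (inv_nonneg.2 ha.le) (h0 _ _ _)
  have k3 : (a : ℝ)⁻¹ * F q.1 q.2 (y q.2) ≤ 1 :=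
    (mul_le_mul ha1 (h1 _ _ _) (h0 _ _ _) zero_le_one).trans_eq (one_mul 1)
  unfold score
  rw [abs_le]
  split_ifs <;> constructor <;> linarith

theorem measurable_score {F : Fin a → Fin d → ℝ → ℝ} (hF : ∀ i j, Measurable (F i j))
    (l : Fin a) (q : Fin a × Fin d) : Measurable (score F l q) := by
  unfold score
  fun_prop

/-! ### The asymptotic covariance matrix as a covariance of scores. -/

section cov

variable (μ : Fin a → Measure (Fin d → ℝ)) [∀ i, IsProbabilityMeasure (μ i)]

theorem abs_score_groupCDF_le_one (l : Fin a) (q : Fin a × Fin d) (y : Fin d → ℝ) :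
    |score (groupCDF μ) l q y| ≤ 1 :=
  abs_score_le_one (groupCDF_nonneg μ) (groupCDF_le_one μ) l q y

@[fun_prop]
theorem measurable_score_groupCDF (l : Fin a) (q : Fin a × Fin d) :
    Measurable (score (groupCDF μ) l q) :=
  measurable_score (measurable_groupCDF μ) l q

theorem memLp_score_groupCDF (l : Fin a) (q : Fin a × Fin d) :
    MemLp (score (groupCDF μ) l q) 2 (μ l) :=
  memLp_two_of_bound (by fun_prop) (abs_score_groupCDF_le_one μ l q)

theorem covariance_score_score (l : Fin a) (q q' : Fin a × Fin d) :
    cov[score (groupCDF μ) l q, score (groupCDF μ) l q'; μ l] =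
      (a : ℝ)⁻¹ * (a : ℝ)⁻¹ *
      ((if q.1 = l then 1 else 0) * (if q'.1 = l then 1 else 0) *
          ∑ k, ∑ k', covF μ l k k' q.2 q'.2
        - (if q.1 = l then 1 else 0) * ∑ k, covF μ l k q'.1 q.2 q'.2
        - (if q'.1 = l then 1 else 0) * ∑ k', covF μ l q.1 k' q.2 q'.2
        + covF μ l q.1 q'.1 q.2 q'.2) := by
  have hF : ∀ i j, MemLp (fun y : Fin d → ℝ => groupCDF μ i j (y j)) 2 (μ l) := fun i j =>
    memLp_two_of_bound (B := 1) (by fun_prop) fun y =>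
      abs_le.2 ⟨by linarith [groupCDF_nonneg μ i j (y j)], groupCDF_le_one μ i j (y j)⟩
  have hS : ∀ j, MemLp (fun y : Fin d → ℝ => ∑ k, groupCDF μ k j (y j)) 2 (μ l) := fun j =>
    memLp_finsetSum _ fun k _ => hF k j
  have hS' : ∀ j (r : ℝ), MemLp (fun y : Fin d → ℝ =>
      r * ((a : ℝ)⁻¹ * ∑ k, groupCDF μ k j (y j))) 2 (μ l) := fun j r =>
    ((hS j).const_mul _).const_mul _
  unfold score
  rw [covariance_fun_sub_fun_sub (hS' _ _) ((hF _ _).const_mul _) (hS' _ _)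
    ((hF _ _).const_mul _)]
  simp only [covariance_const_mul_left, covariance_const_mul_right]
  rw [covariance_fun_sum_left (fun k => hF k _) (hS _),
    covariance_fun_sum_left (fun k => hF k _) (hF _ _),
    covariance_fun_sum_right (fun k => hF k _) (hF _ _)]
  simp_rw [covariance_fun_sum_right (fun k => hF k _) (hF _ _)]
  unfold covF
  ring

/-- The four Kronecker-delta terms of `covW`, summed over both indices and regrouped by the group
whose randomness they carry, are the four products in the bilinear expansion of the covariance of
two scores. -/
theorem asympCov_apply_eq_sum (lam : Fin a → ℝ) (q q' : Fin a × Fin d) :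
    asympCov μ lam q q' =
      ∑ l, (lam l)⁻¹ * cov[score (groupCDF μ) l q, score (groupCDF μ) l q'; μ l] := by
  simp_rw [covariance_score_score]
  obtain ⟨i, j⟩ := q
  obtain ⟨i', j'⟩ := q'
  have h1 : ∑ l, ∑ l', (if l = l' then (lam l)⁻¹ * covF μ l i i' j j' else 0) =
      ∑ l, (lam l)⁻¹ * covF μ l i i' j j' := by simp
  have h2 : ∑ l, ∑ l', (if l = i' then (lam l)⁻¹ * covF μ l i l' j j' else 0) =
      ∑ l, (lam l)⁻¹ * ((if i' = l then 1 else 0) * ∑ l', covF μ l i l' j j') := by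
    simp [← Finset.mul_sum]
  have h3 : ∑ l, ∑ l', (if i = i' then (lam i)⁻¹ * covF μ i l l' j j' else 0) =
      ∑ l, (lam l)⁻¹ * ((if i = l then 1 else 0) * (if i' = l then 1 else 0) *
        ∑ k, ∑ k', covF μ l k k' j j') := by
    by_cases h : i = i'
    · subst h; simp [← Finset.mul_sum]
    · simp [h]
  have h4 : ∑ l, ∑ l', (if i = l' then (lam i)⁻¹ * covF μ i l i' j j' else 0) =
      ∑ l, (lam l)⁻¹ * ((if i = l then 1 else 0) * ∑ k, covF μ l k i' j j') := by
    simp [← Finset.mul_sum]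
  simp only [asympCov, Matrix.of_apply, covW, Finset.sum_add_distrib, Finset.sum_sub_distrib,
    h1, h2, h3, h4]
  rw [← Finset.sum_sub_distrib, ← Finset.sum_add_distrib, ← Finset.sum_sub_distrib,
    Finset.mul_sum]
  refine Finset.sum_congr rfl fun l _ => ?_
  rw [one_div, sq, mul_inv]
  ring

/-- The quadratic form of the asymptotic covariance matrix is a sum of variances. -/
theorem dotProduct_asympCov_mulVec (lam : Fin a → ℝ) (t : Fin a × Fin d → ℝ) :
    t ⬝ᵥ (asympCov μ lam *ᵥ t) =
      ∑ l, (lam l)⁻¹ * Var[fun y => ∑ q, t q * score (groupCDF μ) l q y; μ l] := by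
  have h : ∀ l, Var[fun y => ∑ q, t q * score (groupCDF μ) l q y; μ l] =
      ∑ q, ∑ q', t q * t q' * cov[score (groupCDF μ) l q, score (groupCDF μ) l q'; μ l] := by
    intro l
    have hm : ∀ q, MemLp (fun y => t q * score (groupCDF μ) l q y) 2 (μ l) := fun q =>
      (memLp_score_groupCDF μ l q).const_mul _
    rw [← covariance_self (by fun_prop), covariance_fun_sum_fun_sum hm hm]
    simp only [covariance_const_mul_left, covariance_const_mul_right]
    exact Finset.sum_congr rfl fun _ _ => Finset.sum_congr rfl fun _ _ => by ring
  simp_rw [h, dotProduct, mulVec, dotProduct, asympCov_apply_eq_sum, Finset.mul_sum,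
    Finset.sum_mul]
  conv_rhs => rw [Finset.sum_comm]
  refine Finset.sum_congr rfl fun q _ => ?_
  conv_rhs => rw [Finset.sum_comm]
  exact Finset.sum_congr rfl fun q' _ => by
    rw [Finset.mul_sum]
    exact Finset.sum_congr rfl fun l _ => by ring

theorem asympCov_posSemidef {lam : Fin a → ℝ} (hlam : ∀ i, 0 ≤ lam i) :
    (asympCov μ lam).PosSemidef := by
  refine PosSemidef.of_dotProduct_mulVec_nonneg ?_ fun t => ?_
  · ext q q'
    rw [conjTranspose_apply, asympCov_apply_eq_sum, asympCov_apply_eq_sum, star_trivial]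
    exact Finset.sum_congr rfl fun l _ => by rw [covariance_comm]
  · rw [star_trivial, dotProduct_asympCov_mulVec]
    exact Finset.sum_nonneg fun l _ => mul_nonneg (inv_nonneg.2 (hlam l)) (variance_nonneg _ _)

end cov

end

section
/-! ### Averages and their bootstrap deviations -/

/-- The average of a finite family. -/
noncomputable def avg {n : ℕ} (f : Fin n → ℝ) : ℝ := (∑ k, f k) / (n : ℝ)

/-- The difference of the averages over a resample and over the original sample. -/
noncomputable def bootDev {n : ℕ} (κ : Fin n → Fin n) (f : Fin n → ℝ) : ℝ :=
  avg (fun k => f (κ k)) - avg f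

section avg

variable {n n' : ℕ}

theorem avg_sub (f g : Fin n → ℝ) : avg (fun k => f k - g k) = avg f - avg g := by
  simp only [avg, Finset.sum_sub_distrib, sub_div]

theorem avg_const_mul (r : ℝ) (f : Fin n → ℝ) : avg (fun k => r * f k) = r * avg f := by
  simp only [avg, ← Finset.mul_sum, mul_div_assoc]

theorem avg_sum {ι : Type*} (s : Finset ι) (f : ι → Fin n → ℝ) :
    avg (fun k => ∑ i ∈ s, f i k) = ∑ i ∈ s, avg (f i) := by
  simp only [avg, Finset.sum_div]
  rw [Finset.sum_comm]

theorem avg_const (hn : 0 < n) (r : ℝ) : avg (fun _ : Fin n => r) = r := by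
  have : (n : ℝ) ≠ 0 := by positivity
  simp [avg, this]

theorem avg_comm (B : Fin n → Fin n' → ℝ) :
    avg (fun r => avg (fun k => B r k)) = avg (fun k => avg (fun r => B r k)) := by
  simp only [avg, Finset.sum_div]
  rw [Finset.sum_comm]
  simp only [div_right_comm]

theorem avg_mono {f g : Fin n → ℝ} (h : ∀ k, f k ≤ g k) : avg f ≤ avg g := by
  unfold avg
  gcongr with k
  exact h k

theorem avg_nonneg {f : Fin n → ℝ} (h : ∀ k, 0 ≤ f k) : 0 ≤ avg f :=
  div_nonneg (Finset.sum_nonneg fun k _ => h k) (Nat.cast_nonneg n)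

theorem abs_avg_le_avg_abs (f : Fin n → ℝ) : |avg f| ≤ avg (fun k => |f k|) := by
  unfold avg
  rw [abs_div, abs_of_nonneg (Nat.cast_nonneg (α := ℝ) n)]
  gcongr
  exact Finset.abs_sum_le_sum_abs _ _

theorem avg_le_of_le {f : Fin n → ℝ} {B : ℝ} (hB : 0 ≤ B) (h : ∀ k, f k ≤ B) : avg f ≤ B := by
  -- The average of an empty family is `0 / 0 = 0`, which is where `0 ≤ B` is needed.
  rcases Nat.eq_zero_or_pos n with h0 | h0
  · subst h0; simpa [avg] using hB
  · exact (avg_mono h).trans_eq (avg_const h0 B)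

theorem abs_avg_le {f : Fin n → ℝ} {B : ℝ} (hB : 0 ≤ B) (h : ∀ k, |f k| ≤ B) : |avg f| ≤ B :=
  (abs_avg_le_avg_abs f).trans (avg_le_of_le hB h)

theorem avg_sq_le (f : Fin n → ℝ) : avg f ^ 2 ≤ avg (fun k => f k ^ 2) := by
  rcases Nat.eq_zero_or_pos n with h0 | h0
  · subst h0; simp [avg]
  have : (0 : ℝ) < n := by positivity
  have h := sq_sum_le_card_mul_sum_sq (s := Finset.univ) (f := f)
  simp only [Finset.card_univ, Fintype.card_fin] at h
  unfold avg
  rw [div_pow, div_le_div_iff₀ (by positivity) this]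
  nlinarith

theorem bootDev_sum {ι : Type*} (κ : Fin n → Fin n) (s : Finset ι) (f : ι → Fin n → ℝ) :
    bootDev κ (fun k => ∑ i ∈ s, f i k) = ∑ i ∈ s, bootDev κ (f i) := by
  simp only [bootDev, avg_sum, Finset.sum_sub_distrib]

theorem bootDev_const_mul (κ : Fin n → Fin n) (r : ℝ) (f : Fin n → ℝ) :
    bootDev κ (fun k => r * f k) = r * bootDev κ f := by
  simp only [bootDev, avg_const_mul, mul_sub]

theorem bootDev_sub (κ : Fin n → Fin n) (f g : Fin n → ℝ) :
    bootDev κ (fun k => f k - g k) = bootDev κ f - bootDev κ g := by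
  simp only [bootDev, avg_sub]
  ring

theorem bootDev_const (κ : Fin n → Fin n) (r : ℝ) : bootDev κ (fun _ => r) = 0 := by
  simp [bootDev]

theorem bootDev_comm (κ : Fin n → Fin n) (κ' : Fin n' → Fin n') (B : Fin n → Fin n' → ℝ) :
    bootDev κ (fun r => bootDev κ' (fun k => B r k)) =
      bootDev κ' (fun k => bootDev κ (fun r => B r k)) := by
  simp only [bootDev, avg_sub]
  rw [avg_comm (fun r k => B (κ r) (κ' k)), avg_comm (fun r k => B (κ r) k),
    avg_comm (fun r k => B r (κ' k)), avg_comm B]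
  ring

/-- The second-order expansion of a double average over resamples. -/
theorem avg_avg_resample_sub (κ : Fin n → Fin n) (κ' : Fin n' → Fin n') (B : Fin n → Fin n' → ℝ) :
    avg (fun r => avg (fun k => B (κ r) (κ' k))) - avg (fun r => avg (fun k => B r k)) =
      bootDev κ (fun r => avg (fun k => B r k)) + bootDev κ' (fun k => avg (fun r => B r k)) +
        bootDev κ (fun r => bootDev κ' (fun k => B r k)) := by
  simp only [bootDev, avg_sub]
  rw [avg_comm (fun r k => B r (κ' k)), avg_comm B]
  ring

end avg

/-! ### Decomposition of the bootstrap effects -/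

variable {a d : ℕ} {n : Fin a → ℕ}

/-- The second-order term in the expansion of the bootstrap effects. -/
noncomputable def bootRem (x : Sample n d) (κ : (i : Fin a) → Fin (n i) → Fin (n i))
    (i : Fin a) (j : Fin d) (l : Fin a) : ℝ :=
  bootDev (κ i) (fun r => bootDev (κ l) (fun k => c (x i r j - x l k j)))

/-- Swapping the two arguments of the kernel replaces it by 1 minus itself, and `bootDev` kills
constants. With the same draw in both slots the bilinear term is therefore its own negative. This
disposes of the one case in which the two resamples are not independent. -/
theorem bootRem_self (x : Sample n d) (κ : (i : Fin a) → Fin (n i) → Fin (n i))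
    (i : Fin a) (j : Fin d) : bootRem x κ i j i = 0 := by
  have h : bootRem x κ i j i = - bootRem x κ i j i := by
    conv_lhs => unfold bootRem
    have e : ∀ r k, c (x i r j - x i k j) = 1 - c (x i k j - x i r j) := fun r k => by
      rw [← c_neg, neg_sub]
    have e' : (fun r => bootDev (κ i) (fun k => c (x i r j - x i k j))) =
        fun r => 0 - bootDev (κ i) (fun k => c (x i k j - x i r j)) := by
      funext r
      rw [← bootDev_const (κ i) 1, ← bootDev_sub]
      exact congrArg _ (funext (e r))
    rw [e', bootDev_sub, bootDev_const, zero_sub, bootDev_comm]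
    rfl
  linarith

theorem estEffect_eq_sum (x : Sample n d) (q : Fin a × Fin d) :
    estEffect x q = (a : ℝ)⁻¹ * ∑ l, avg (fun r => avg (fun k => c (x q.1 r q.2 - x l k q.2))) := by
  rw [← avg_sum, ← avg_const_mul]
  unfold estEffect
  congr 1
  refine Finset.sum_congr rfl fun r _ => ?_
  rw [meanEcdf, div_eq_inv_mul]
  rfl

/-- A Hoeffding-type decomposition, exact for every resample. The linear part of the pairwise effect
of `l` and `i` is the deviation of the distribution function of `l` over group `i` minus that of `i`
over group `l`; collecting by the group being resampled produces `score`. -/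
theorem estEffect_resample_sub (hn : ∀ i, 0 < n i) (x : Sample n d)
    (κ : (i : Fin a) → Fin (n i) → Fin (n i)) (q : Fin a × Fin d) :
    (estEffect (resample x κ) - estEffect x) q =
      ∑ l, bootDev (κ l) (fun k => score (ecdf x) l q (x l k)) +
        (a : ℝ)⁻¹ * ∑ l, bootRem x κ q.1 q.2 l := by
  obtain ⟨i, j⟩ := q
  have hsplit : ∀ l, avg (fun r => avg (fun k => c (x i (κ i r) j - x l (κ l k) j))) -
      avg (fun r => avg (fun k => c (x i r j - x l k j))) =
      bootDev (κ i) (fun r => ecdf x l j (x i r j)) - bootDev (κ l) (fun k => ecdf x i j (x l k j))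
        + bootRem x κ i j l := by
    intro l
    rw [avg_avg_resample_sub (κ i) (κ l) (fun r k => c (x i r j - x l k j))]
    have e : ∀ k, avg (fun r => c (x i r j - x l k j)) = 1 - ecdf x i j (x l k j) := by
      intro k
      have : ∀ r, c (x i r j - x l k j) = 1 - c (x l k j - x i r j) := fun r => by
        rw [← c_neg, neg_sub]
      simp_rw [this, avg_sub, avg_const (hn i)]
      rfl
    simp_rw [e, bootDev_sub, bootDev_const]
    rw [zero_sub, ← sub_eq_add_neg]
    rfl
  have hs : ∀ l, bootDev (κ l) (fun k => score (ecdf x) l (i, j) (x l k)) =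
      (if i = l then 1 else 0) * ((a : ℝ)⁻¹ * ∑ l', bootDev (κ l)
        (fun k => ecdf x l' j (x l k j))) -
        (a : ℝ)⁻¹ * bootDev (κ l) (fun k => ecdf x i j (x l k j)) := by
    intro l
    unfold score
    rw [bootDev_sub, bootDev_const_mul, bootDev_const_mul, bootDev_const_mul, bootDev_sum]
  rw [Pi.sub_apply, estEffect_eq_sum, estEffect_eq_sum, ← mul_sub, ← Finset.sum_sub_distrib]
  simp only [resample]
  simp_rw [hsplit, hs]
  rw [Finset.sum_add_distrib, Finset.sum_sub_distrib, Finset.sum_sub_distrib, ← Finset.mul_sum]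
  simp only [ite_mul, one_mul, zero_mul, Finset.sum_ite_eq, Finset.mem_univ, if_true]
  ring

/-! ### Moments under resampling -/

theorem integral_uniformOn_univ {E : Type*} [NormedAddCommGroup E] [NormedSpace ℝ E]
    [CompleteSpace E] {n : ℕ} (f : Fin n → E) :
    ∫ k, f k ∂(uniformOn (Set.univ : Set (Fin n))) = (n : ℝ)⁻¹ • ∑ k, f k := by
  rw [integral_fintype (.of_finite), Finset.smul_sum]
  refine Finset.sum_congr rfl fun k _ => ?_
  congr 1
  rw [measureReal_def, uniformOn_univ]
  simp

instance isProbabilityMeasure_pi_uniformOn (n : ℕ) : IsProbabilityMeasure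
    (Measure.pi fun _ : Fin n => uniformOn (Set.univ : Set (Fin n))) := by
  have : ∀ k : Fin n, IsProbabilityMeasure (uniformOn (Set.univ : Set (Fin n))) := fun k => by
    have : Nonempty (Fin n) := ⟨k⟩
    infer_instance
  infer_instance

/-- Given the sample, the resample average is a mean of `n` i.i.d. draws with expectation `avg f`,
so the left side is its variance; the variance of one draw is at most its second moment. -/
theorem integral_bootDev_sq_le {n : ℕ} (f : Fin n → ℝ) :
    ∫ κ, bootDev κ f ^ 2 ∂(Measure.pi fun _ : Fin n => uniformOn (Set.univ : Set (Fin n))) ≤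
      (n : ℝ)⁻¹ * avg (fun k => f k ^ 2) := by
  rcases Nat.eq_zero_or_pos n with h0 | h0
  · subst h0; simp [bootDev, avg]
  have hn : (0 : ℝ) < n := by positivity
  have hne : Nonempty (Fin n) := ⟨⟨0, h0⟩⟩
  set ν := Measure.pi fun _ : Fin n => uniformOn (Set.univ : Set (Fin n)) with hν
  set S : (Fin n → Fin n) → ℝ := ∑ k, fun κ => (n : ℝ)⁻¹ * f (κ k) with hS
  have hmean : ∫ κ, S κ ∂ν = avg f := by
    simp only [hS, Finset.sum_apply]
    rw [integral_finsetSum _ fun _ _ => .of_finite]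
    have : ∀ k : Fin n, ∫ κ, (n : ℝ)⁻¹ * f (κ k) ∂ν = (n : ℝ)⁻¹ * avg f := by
      intro k
      rw [integral_const_mul, hν,
        integral_comp_eval (μ := fun _ : Fin n => uniformOn (Set.univ : Set (Fin n)))
          (i := k) (f := f) (measurable_of_finite _).aestronglyMeasurable,
        integral_uniformOn_univ, smul_eq_mul, avg, div_eq_inv_mul]
    rw [Finset.sum_congr rfl fun k _ => this k]
    simp [hn.ne']
  have hdev : ∀ κ, bootDev κ f = S κ - avg f := fun κ => by
    simp only [bootDev, hS, Finset.sum_apply, ← Finset.mul_sum]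
    rw [avg, div_eq_inv_mul]
  have hvar : Var[S; ν] = ∑ _k : Fin n, Var[fun r => (n : ℝ)⁻¹ * f r;
      uniformOn (Set.univ : Set (Fin n))] :=
    variance_sum_pi (X := fun _ r => (n : ℝ)⁻¹ * f r) fun _ => .of_discrete
  have hle : Var[fun r => (n : ℝ)⁻¹ * f r; uniformOn (Set.univ : Set (Fin n))] ≤
      (n : ℝ)⁻¹ * ((n : ℝ)⁻¹ * avg (fun k => f k ^ 2)) := by
    refine (variance_le_expectation_sq (measurable_of_finite _).aestronglyMeasurable).trans_eq ?_
    rw [integral_uniformOn_univ, smul_eq_mul]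
    simp only [Pi.pow_apply, mul_pow, ← Finset.mul_sum, avg]
    ring
  simp_rw [hdev]
  rw [← hmean, ← variance_eq_integral (measurable_of_finite _).aemeasurable, hvar]
  refine (Finset.sum_le_sum fun _ _ => hle).trans_eq ?_
  simp
  field_simp

/-- Nonnegativity of the variance of `|f|`. -/
theorem integral_abs_sq_le {α : Type*} [MeasurableSpace α] {ρ : Measure α}
    [IsProbabilityMeasure ρ] {f : α → ℝ} (hf : MemLp f 2 ρ) :
    (∫ y, |f y| ∂ρ) ^ 2 ≤ ∫ y, f y ^ 2 ∂ρ := by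
  have h := variance_nonneg |f| ρ
  rw [variance_eq_sub hf.abs] at h
  simp only [Pi.pow_apply, Pi.abs_apply, sq_abs] at h
  linarith

theorem integral_drawLaw_prodMk {i l : Fin a} (hil : i ≠ l)
    (f : (Fin (n i) → Fin (n i)) → (Fin (n l) → Fin (n l)) → ℝ) :
    ∫ κ, f (κ i) (κ l) ∂(drawLaw n) =
      ∫ κ', ∫ κ, f κ κ' ∂(Measure.pi fun _ : Fin (n i) => uniformOn (Set.univ : Set (Fin (n i))))
        ∂(Measure.pi fun _ : Fin (n l) => uniformOn (Set.univ : Set (Fin (n l)))) := by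
  set ν : (i : Fin a) → Measure (Fin (n i) → Fin (n i)) := fun i =>
    Measure.pi fun _ : Fin (n i) => uniformOn (Set.univ : Set (Fin (n i))) with hν
  have hind : IndepFun (fun κ : (i : Fin a) → Fin (n i) → Fin (n i) => κ i) (fun κ => κ l)
      (Measure.pi ν) :=
    (iIndepFun_pi (μ := ν) (X := fun i κ => κ) fun i => aemeasurable_id).indepFun hil
  have hmap := hind.map_prod_eq_prod_map_map (measurable_pi_apply _).aemeasurable
    (measurable_pi_apply _).aemeasurable
  rw [(measurePreserving_eval ν i).map_eq, (measurePreserving_eval ν l).map_eq] at hmap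
  have h1 : ∫ κ, f (κ i) (κ l) ∂(drawLaw n) = ∫ p, f p.1 p.2 ∂((ν i).prod (ν l)) := by
    rw [← hmap, integral_map (measurable_of_finite _).aemeasurable
      (measurable_of_finite _).aestronglyMeasurable]
    rfl
  rw [h1, integral_prod_symm _ .of_finite]

/-- Distinct groups are resampled independently, so the variance bound applies in one group with the
other resample frozen and then in the other group. Each application gains an inverse sample size. -/
theorem integral_bootRem_sq_le (x : Sample n d) {i l : Fin a} (hil : i ≠ l) (j : Fin d) :
    ∫ κ, bootRem x κ i j l ^ 2 ∂(drawLaw n) ≤ (n i : ℝ)⁻¹ * (n l : ℝ)⁻¹ := by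
  unfold bootRem
  rw [integral_drawLaw_prodMk hil (fun κ κ' =>
    bootDev κ (fun r => bootDev κ' (fun k => c (x i r j - x l k j))) ^ 2)]
  set νl := Measure.pi fun _ : Fin (n l) => uniformOn (Set.univ : Set (Fin (n l))) with hνl
  have hc : ∀ r, ∫ κ', bootDev κ' (fun k => c (x i r j - x l k j)) ^ 2 ∂νl ≤ (n l : ℝ)⁻¹ := by
    intro r
    refine (integral_bootDev_sq_le _).trans ?_
    refine mul_le_of_le_one_right (by positivity) (avg_le_of_le zero_le_one fun k => ?_)
    exact (sq_le_one_iff_abs_le_one _).2 (abs_c_le_one _)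
  calc _ ≤ ∫ κ', (n i : ℝ)⁻¹ * avg (fun r => bootDev κ' (fun k => c (x i r j - x l k j)) ^ 2) ∂νl :=
        integral_mono .of_finite .of_finite fun κ' => integral_bootDev_sq_le _
    _ = (n i : ℝ)⁻¹ * avg (fun r => ∫ κ', bootDev κ' (fun k => c (x i r j - x l k j)) ^ 2 ∂νl) := by
        rw [integral_const_mul]
        simp only [avg]
        rw [integral_div, integral_finsetSum _ fun _ _ => .of_finite]
    _ ≤ (n i : ℝ)⁻¹ * (n l : ℝ)⁻¹ := by
        gcongr
        exact avg_le_of_le (by positivity) hc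

theorem integral_abs_bootRem_le (x : Sample n d) (i l : Fin a) (j : Fin d) :
    ∫ κ, |bootRem x κ i j l| ∂(drawLaw n) ≤ √((n i : ℝ)⁻¹ * (n l : ℝ)⁻¹) := by
  by_cases hil : i = l
  · subst hil
    simp only [bootRem_self, abs_zero, integral_zero]
    positivity
  · refine Real.le_sqrt_of_sq_le ?_
    exact (integral_abs_sq_le .of_discrete).trans (integral_bootRem_sq_le x hil j)

end

section
/-! ### Characteristic functions under resampling -/

/-- Taking logarithms, `k * log (1 + g)` differs from `k * g` by at most a multiple of `k * g ^ 2`,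
which vanishes because `k * g` converges and `g` tends to zero. -/
theorem tendsto_one_add_pow_exp {k : ℕ → ℕ} {g : ℕ → ℂ} {z : ℂ} (hk : Tendsto k atTop atTop)
    (hg : Tendsto (fun m => (k m : ℂ) * g m) atTop (𝓝 z)) :
    Tendsto (fun m => (1 + g m) ^ k m) atTop (𝓝 (Complex.exp z)) := by
  have hkinv : Tendsto (fun m => ((k m : ℂ))⁻¹) atTop (𝓝 0) :=
    (tendsto_inv_atTop_nhds_zero_nat (𝕜 := ℂ)).comp hk
  have hk0 : ∀ᶠ m in atTop, k m ≠ 0 := hk.eventually_ne_atTop 0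
  have hg0 : Tendsto g atTop (𝓝 0) := by
    have := hg.mul hkinv
    rw [mul_zero] at this
    refine this.congr' ?_
    filter_upwards [hk0] with m hm
    have : (k m : ℂ) ≠ 0 := by exact_mod_cast hm
    field_simp
  have hgn : Tendsto (fun m => ‖g m‖) atTop (𝓝 0) := by simpa using hg0.norm
  have hsmall : ∀ᶠ m in atTop, ‖g m‖ ≤ 1 / 2 := hgn.eventually_le_const (by norm_num)
  have hlog : Tendsto (fun m => (k m : ℂ) * Complex.log (1 + g m)) atTop (𝓝 z) := by
    have hdiff : Tendsto (fun m => (k m : ℂ) * (Complex.log (1 + g m) - g m)) atTop (𝓝 0) := by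
      have hb := hg.norm.mul hgn
      rw [mul_zero] at hb
      refine squeeze_zero_norm' ?_ hb
      filter_upwards [hsmall] with m hm
      rw [norm_mul, norm_mul, mul_assoc]
      refine mul_le_mul_of_nonneg_left ?_ (norm_nonneg _)
      refine (Complex.norm_log_one_add_sub_self_le (by linarith)).trans ?_
      have h1 : (1 - ‖g m‖)⁻¹ ≤ 2 := by
        rw [inv_le_comm₀ (by linarith) (by norm_num)]
        linarith
      have : ‖g m‖ ^ 2 * (1 - ‖g m‖)⁻¹ ≤ ‖g m‖ ^ 2 * 2 := by gcongr
      nlinarith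
    have := hg.add hdiff
    rw [add_zero] at this
    exact this.congr fun m => by ring
  refine ((Complex.continuous_exp.tendsto _).comp hlog).congr' ?_
  filter_upwards [hsmall] with m hm
  have hne : 1 + g m ≠ 0 := by
    intro h
    have h1 : g m = -1 := by linear_combination h
    rw [h1, norm_neg, norm_one] at hm
    norm_num at hm
  rw [Function.comp, mul_comm, ← Complex.cpow_def_of_ne_zero hne, Complex.cpow_natCast]

/-- The characteristic function of a bootstrap deviation. -/
theorem integral_exp_bootDev {n : ℕ} (hn : 0 < n) (s : ℝ) (f : Fin n → ℝ) :
    ∫ κ, Complex.exp (((s * bootDev κ f : ℝ) : ℂ) * Complex.I)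
        ∂(Measure.pi fun _ : Fin n => uniformOn (Set.univ : Set (Fin n))) =
      ((n : ℝ)⁻¹ • ∑ k, Complex.exp (((s / n * (f k - avg f) : ℝ) : ℂ) * Complex.I)) ^ n := by
  have hne : Nonempty (Fin n) := ⟨⟨0, hn⟩⟩
  have hn0 : (n : ℝ) ≠ 0 := by positivity
  have h : ∀ κ : Fin n → Fin n, Complex.exp (((s * bootDev κ f : ℝ) : ℂ) * Complex.I) =
      ∏ k, Complex.exp (((s / n * (f (κ k) - avg f) : ℝ) : ℂ) * Complex.I) := by
    intro κ
    -- Centring every draw by `avg f` absorbs the subtracted average, so the exponential factors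
    -- over the independent draws.
    have e : s * bootDev κ f = ∑ k, s / n * (f (κ k) - avg f) := by
      rw [← Finset.mul_sum, Finset.sum_sub_distrib, bootDev, avg]
      simp
      field_simp
    rw [← Complex.exp_sum, ← Finset.sum_mul, e, Complex.ofReal_sum]
  simp_rw [h]
  rw [integral_fintype_prod_eq_pow (μ := uniformOn (Set.univ : Set (Fin n)))
    (f := fun r : Fin n => Complex.exp (((s / n * (f r - avg f) : ℝ) : ℂ) * Complex.I)),
    integral_uniformOn_univ, Fintype.card_fin]

theorem norm_exp_sub_taylor_le (z : ℂ) :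
    ‖Complex.exp z - (1 + z + z ^ 2 / 2)‖ ≤ ‖z‖ ^ 3 * Real.exp ‖z‖ := by
  have h := Complex.norm_exp_sub_sum_le_norm_mul_exp z 3
  simpa [Finset.sum_range_succ, Nat.factorial] using h

/-- A central limit theorem for uniformly bounded bootstrap deviations. -/
theorem tendsto_integral_exp_bootDev {k : ℕ → ℕ} (hk : Tendsto k atTop atTop) {s : ℕ → ℝ} {r : ℝ}
    (hs : Tendsto (fun m => s m ^ 2 / k m) atTop (𝓝 r)) (f : (m : ℕ) → Fin (k m) → ℝ) {B : ℝ}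
    (hB : ∀ m i, |f m i| ≤ B) {v : ℝ}
    (hv : Tendsto (fun m => avg (fun i => f m i ^ 2) - avg (f m) ^ 2) atTop (𝓝 v)) :
    Tendsto (fun m => ∫ κ, Complex.exp (((s m * bootDev κ (f m) : ℝ) : ℂ) * Complex.I)
        ∂(Measure.pi fun _ : Fin (k m) => uniformOn (Set.univ : Set (Fin (k m)))))
      atTop (𝓝 (Complex.exp ((-(r * v / 2) : ℝ) : ℂ))) := by
  have hk0 : ∀ᶠ m in atTop, 0 < k m := hk.eventually_gt_atTop 0
  have hkinv : Tendsto (fun m => ((k m : ℝ))⁻¹) atTop (𝓝 0) :=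
    tendsto_inv_atTop_zero.comp (tendsto_natCast_atTop_atTop.comp hk)
  set θ : ℕ → ℝ := fun m => s m / k m with hθ
  have hθ0 : Tendsto (fun m => |θ m|) atTop (𝓝 0) := by
    have h2 : Tendsto (fun m => θ m ^ 2) atTop (𝓝 0) := by
      have := hs.mul hkinv
      rw [mul_zero] at this
      refine this.congr fun m => ?_
      simp only [hθ, div_pow]
      ring
    have := h2.sqrt
    simpa [Real.sqrt_sq_eq_abs] using this
  set w : (m : ℕ) → Fin (k m) → ℝ := fun m i => f m i - avg (f m) with hw
  -- The characteristic function of one centred draw at `θ m`, minus 1; the full one is the `k m`-th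
  -- power of `1 + g m`.
  set g : ℕ → ℂ := fun m =>
    ((k m : ℝ)⁻¹ • ∑ i, Complex.exp (((θ m * w m i : ℝ) : ℂ) * Complex.I)) - 1 with hgdef
  -- `hB` says nothing about `B` when the sample is empty.
  have hB' : ∀ᶠ _ : ℕ in atTop, 0 ≤ B := by
    filter_upwards [hk0] with m hm
    exact (abs_nonneg _).trans (hB m ⟨0, hm⟩)
  have hwB : ∀ᶠ m in atTop, ∀ i, |w m i| ≤ 2 * B := by
    filter_upwards [hB'] with m hB0 i
    refine (abs_sub _ _).trans ?_
    linarith [hB m i, abs_avg_le hB0 (hB m)]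
  have hmain : Tendsto (fun m => (((s m ^ 2 / k m) *
      (avg (fun i => f m i ^ 2) - avg (f m) ^ 2) / 2 : ℝ) : ℂ)) atTop
      (𝓝 ((r * v / 2 : ℝ) : ℂ)) :=
    (Complex.continuous_ofReal.tendsto _).comp ((hs.mul hv).div_const 2)
  have hg : Tendsto (fun m => (k m : ℂ) * g m) atTop (𝓝 ((-(r * v / 2) : ℝ) : ℂ)) := by
    -- The `k m` cubic Taylor remainders add up to order `k m * |θ m| ^ 3 = (s m ^ 2 / k m) * |θ
    -- m|`. The linear terms cancel by centring and the quadratic ones give the variance; uniform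
    -- boundedness replaces a Lindeberg condition.
    have hbound : Tendsto (fun m => (s m ^ 2 / k m) * |θ m| * ((2 * B) ^ 3 *
        Real.exp (|θ m| * (2 * B)))) atTop (𝓝 0) := by
      have he : Tendsto (fun m => Real.exp (|θ m| * (2 * B))) atTop (𝓝 (Real.exp (0 * (2 * B)))) :=
        (Real.continuous_exp.tendsto _).comp (hθ0.mul_const _)
      have := (hs.mul hθ0).mul (he.const_mul ((2 * B) ^ 3))
      simpa using this
    have herr : Tendsto (fun m => (k m : ℂ) * g m + (((s m ^ 2 / k m) *
        (avg (fun i => f m i ^ 2) - avg (f m) ^ 2) / 2 : ℝ) : ℂ)) atTop (𝓝 0) := by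
      refine squeeze_zero_norm' ?_ hbound
      filter_upwards [hk0, hwB, hB'] with m hm hwm hB0
      have hkm : (k m : ℝ) ≠ 0 := by positivity
      have hkmc : (k m : ℂ) ≠ 0 := by exact_mod_cast hm.ne'
      have e1 : ∑ i, w m i = 0 := by
        simp only [hw, Finset.sum_sub_distrib, avg]
        simp
        field_simp
        ring
      have e2 : ∑ i, w m i ^ 2 = k m * (avg (fun i => f m i ^ 2) - avg (f m) ^ 2) := by
        have : ∀ i, w m i ^ 2 = f m i ^ 2 - 2 * avg (f m) * f m i + avg (f m) ^ 2 := fun i => by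
          simp only [hw]; ring
        simp_rw [this]
        rw [Finset.sum_add_distrib, Finset.sum_sub_distrib, ← Finset.mul_sum]
        have h1 : ∑ i, f m i = k m * avg (f m) := by rw [avg]; field_simp
        have h2 : ∑ i, f m i ^ 2 = k m * avg (fun i => f m i ^ 2) := by rw [avg]; field_simp
        rw [h1, h2]
        simp
        ring
      have e3 : (k m : ℂ) * g m + (((s m ^ 2 / k m) *
          (avg (fun i => f m i ^ 2) - avg (f m) ^ 2) / 2 : ℝ) : ℂ) =
          ∑ i, (Complex.exp (((θ m * w m i : ℝ) : ℂ) * Complex.I) -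
            (1 + ((θ m * w m i : ℝ) : ℂ) * Complex.I +
              (((θ m * w m i : ℝ) : ℂ) * Complex.I) ^ 2 / 2)) := by
        have h1 : ∀ i, (1 + ((θ m * w m i : ℝ) : ℂ) * Complex.I +
            (((θ m * w m i : ℝ) : ℂ) * Complex.I) ^ 2 / 2) =
            1 + Complex.I * θ m * (w m i : ℂ) - (θ m : ℂ) ^ 2 / 2 * ((w m i ^ 2 : ℝ) : ℂ) := by
          intro i
          rw [mul_pow, Complex.I_sq]
          push_cast
          ring
        simp_rw [h1]
        rw [Finset.sum_sub_distrib, Finset.sum_sub_distrib, Finset.sum_add_distrib,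
          ← Finset.mul_sum, ← Finset.mul_sum, ← Complex.ofReal_sum, ← Complex.ofReal_sum, e1, e2]
        have hθm : (θ m : ℂ) = s m / k m := by simp [hθ]
        simp only [hgdef, Complex.real_smul]
        generalize ∑ i, Complex.exp (((θ m * w m i : ℝ) : ℂ) * Complex.I) = E
        rw [hθm]
        simp
        field_simp
        ring
      rw [e3]
      refine (norm_sum_le _ _).trans ?_
      calc _ ≤ ∑ _i : Fin (k m), (|θ m| * (2 * B)) ^ 3 * Real.exp (|θ m| * (2 * B)) := by
            refine Finset.sum_le_sum fun i _ => ?_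
            refine (norm_exp_sub_taylor_le _).trans ?_
            have hz : ‖((θ m * w m i : ℝ) : ℂ) * Complex.I‖ ≤ |θ m| * (2 * B) := by
              rw [norm_mul, Complex.norm_I, mul_one, Complex.norm_real, Real.norm_eq_abs, abs_mul]
              exact mul_le_mul_of_nonneg_left (hwm i) (abs_nonneg _)
            gcongr
        _ = _ := by
            rw [Finset.sum_const, Finset.card_univ, Fintype.card_fin, nsmul_eq_mul]
            have : s m ^ 2 / k m = k m * |θ m| ^ 2 := by
              rw [sq_abs]; simp only [hθ]; field_simp
            rw [this]
            ring
    have := herr.sub hmain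
    rw [zero_sub] at this
    rw [Complex.ofReal_neg]
    refine this.congr fun m => by ring
  refine (tendsto_one_add_pow_exp hk hg).congr' ?_
  filter_upwards [hk0] with m hm
  rw [integral_exp_bootDev hm]
  simp only [hgdef, hθ, hw, add_sub_cancel]

end

section
/-! ### The conditional central limit theorem for a sequence of samples -/

section SampleSize

variable {a : ℕ} {n : ℕ → Fin a → ℕ} {lam : Fin a → ℝ}

theorem tendsto_sampleSize (hN : Tendsto (fun m => ∑ i, n m i) atTop atTop)
    (hlam : ∀ i, 0 < lam i)
    (hfrac : ∀ i, Tendsto (fun m => (n m i : ℝ) / ((∑ l, n m l : ℕ) : ℝ)) atTop (𝓝 (lam i)))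
    (i : Fin a) : Tendsto (fun m => n m i) atTop atTop := by
  have hNr : Tendsto (fun m => ((∑ l, n m l : ℕ) : ℝ)) atTop atTop :=
    tendsto_natCast_atTop_atTop.comp hN
  refine tendsto_natCast_atTop_iff (R := ℝ).1 ?_
  refine (Tendsto.pos_mul_atTop (hlam i) (hfrac i) hNr).congr' ?_
  filter_upwards [hNr.eventually_ne_atTop 0] with m hm
  field_simp

theorem tendsto_total_div_sampleSize (hlam : ∀ i, 0 < lam i)
    (hfrac : ∀ i, Tendsto (fun m => (n m i : ℝ) / ((∑ l, n m l : ℕ) : ℝ)) atTop (𝓝 (lam i)))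
    (i : Fin a) :
    Tendsto (fun m => ((∑ l, n m l : ℕ) : ℝ) / n m i) atTop (𝓝 (lam i)⁻¹) :=
  ((hfrac i).inv₀ (hlam i).ne').congr fun _ => inv_div _ _

end SampleSize

variable {a d : ℕ} {n : ℕ → Fin a → ℕ}

/-- The linear combination of the estimated scores with coefficients `t`. -/
noncomputable def scoreComb {n : Fin a → ℕ} (t : Fin a × Fin d → ℝ) (x : Sample n d) (l : Fin a)
    (k : Fin (n l)) : ℝ := ∑ q, t q * score (ecdf x) l q (x l k)

theorem sum_mul_estEffect_resample_sub {n : Fin a → ℕ} (hn : ∀ i, 0 < n i) (x : Sample n d)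
    (κ : (i : Fin a) → Fin (n i) → Fin (n i)) (t : Fin a × Fin d → ℝ) :
    ∑ q, t q * (estEffect (resample x κ) - estEffect x) q =
      ∑ l, bootDev (κ l) (scoreComb t x l) +
        ∑ q, t q * ((a : ℝ)⁻¹ * ∑ l, bootRem x κ q.1 q.2 l) := by
  simp_rw [estEffect_resample_sub hn, mul_add, Finset.sum_add_distrib]
  congr 1
  unfold scoreComb
  simp_rw [bootDev_sum, bootDev_const_mul, Finset.mul_sum]
  rw [Finset.sum_comm]

theorem ecdf_nonneg {n : Fin a → ℕ} (x : Sample n d) (i : Fin a) (j : Fin d) (t : ℝ) :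
    0 ≤ ecdf x i j t :=
  avg_nonneg fun _ => c_nonneg _

theorem ecdf_le_one {n : Fin a → ℕ} (x : Sample n d) (i : Fin a) (j : Fin d) (t : ℝ) :
    ecdf x i j t ≤ 1 :=
  avg_le_of_le zero_le_one fun _ => c_le_one _

theorem abs_sum_mul_le {ι : Type*} [Fintype ι] (t : ι → ℝ) {f : ι → ℝ} (hf : ∀ q, |f q| ≤ 1) :
    |∑ q, t q * f q| ≤ ∑ q, |t q| := by
  refine (Finset.abs_sum_le_sum_abs _ _).trans (Finset.sum_le_sum fun q _ => ?_)
  rw [abs_mul]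
  exact mul_le_of_le_one_right (abs_nonneg _) (hf q)

/-- Convergence of the empirical quantities on which the bootstrap law depends. -/
structure EmpiricalLimit (μ : Fin a → Measure (Fin d → ℝ)) (x : (m : ℕ) → Sample (n m) d) :
    Prop where
  ecdf_sub : ∀ l i j, Tendsto (fun m => avg fun k =>
    (ecdf (x m) i j (x m l k j) - groupCDF μ i j (x m l k j)) ^ 2) atTop (𝓝 0)
  mul : ∀ l q q', Tendsto (fun m => avg fun k =>
    score (groupCDF μ) l q (x m l k) * score (groupCDF μ) l q' (x m l k)) atTop
      (𝓝 (∫ y, score (groupCDF μ) l q y * score (groupCDF μ) l q' y ∂(μ l)))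
  mean : ∀ l q, Tendsto (fun m => avg fun k => score (groupCDF μ) l q (x m l k)) atTop
      (𝓝 (∫ y, score (groupCDF μ) l q y ∂(μ l)))

section

variable {μ : Fin a → Measure (Fin d → ℝ)} [∀ i, IsProbabilityMeasure (μ i)]
  {x : (m : ℕ) → Sample (n m) d}

/-- Mean-square closeness of the distribution functions at the data points gives closeness of the
scores in mean. As all scores are bounded, empirical first and second moments may be computed with
the true distribution functions, where `mean` and `mul` apply. -/
theorem EmpiricalLimit.tendsto_variance_scoreComb (hx : EmpiricalLimit μ x)
    (t : Fin a × Fin d → ℝ) (l : Fin a) :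
    Tendsto (fun m => avg (fun k => scoreComb t (x m) l k ^ 2) - avg (scoreComb t (x m) l) ^ 2)
      atTop (𝓝 (Var[fun y => ∑ q, t q * score (groupCDF μ) l q y; μ l])) := by
  set u : (Fin d → ℝ) → ℝ := fun y => ∑ q, t q * score (groupCDF μ) l q y with hu
  set B : ℝ := ∑ q, |t q| with hBdef
  have hB0 : 0 ≤ B := Finset.sum_nonneg fun _ _ => abs_nonneg _
  have huB : ∀ y, |u y| ≤ B := fun y => abs_sum_mul_le t fun q => abs_score_groupCDF_le_one μ l q y
  have hsB : ∀ m k, |scoreComb t (x m) l k| ≤ B := fun m k =>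
    abs_sum_mul_le t fun q => abs_score_le_one (ecdf_nonneg _) (ecdf_le_one _) l q _
  have hum : Measurable u := by fun_prop
  have hint : ∀ q, Integrable (score (groupCDF μ) l q) (μ l) := fun q =>
    integrable_of_bound (by fun_prop) (abs_score_groupCDF_le_one μ l q)
  have hint2 : ∀ q q', Integrable (fun y => score (groupCDF μ) l q y * score (groupCDF μ) l q' y)
      (μ l) := fun q q' => (memLp_score_groupCDF μ l q).integrable_mul (memLp_score_groupCDF μ l q')
  have hmean : Tendsto (fun m => avg fun k => u (x m l k)) atTop (𝓝 (∫ y, u y ∂(μ l))) := by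
    simp only [hu]
    rw [integral_finsetSum _ fun q _ => (hint q).const_mul _]
    simp_rw [avg_sum, avg_const_mul, integral_const_mul]
    exact tendsto_finsetSum _ fun q _ => (hx.mean l q).const_mul _
  have hsq : Tendsto (fun m => avg fun k => u (x m l k) ^ 2) atTop (𝓝 (∫ y, u y ^ 2 ∂(μ l))) := by
    have e : ∀ y, u y ^ 2 = ∑ q, ∑ q', t q * t q' *
        (score (groupCDF μ) l q y * score (groupCDF μ) l q' y) := fun y => by
      rw [sq, hu, Finset.sum_mul_sum]
      exact Finset.sum_congr rfl fun _ _ => Finset.sum_congr rfl fun _ _ => by ring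
    simp_rw [e]
    rw [integral_finsetSum _ fun q _ => integrable_finsetSum _ fun q' _ =>
      (hint2 q q').const_mul _]
    simp_rw [integral_finsetSum _ fun q' _ => (hint2 _ q').const_mul _, avg_sum, avg_const_mul,
      integral_const_mul]
    exact tendsto_finsetSum _ fun q _ => tendsto_finsetSum _ fun q' _ => (hx.mul l q q').const_mul _
  have habs : ∀ i j, Tendsto (fun m => avg fun k =>
      |ecdf (x m) i j (x m l k j) - groupCDF μ i j (x m l k j)|) atTop (𝓝 0) := by
    intro i j
    have h1 := (hx.ecdf_sub l i j).sqrt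
    rw [Real.sqrt_zero] at h1
    refine squeeze_zero (fun m => avg_nonneg fun _ => abs_nonneg _) (fun m => ?_) h1
    refine Real.le_sqrt_of_sq_le ((avg_sq_le _).trans_eq ?_)
    simp only [sq_abs]
  have hdiff : Tendsto (fun m => avg fun k => |scoreComb t (x m) l k - u (x m l k)|) atTop
      (𝓝 0) := by
    have hlim : Tendsto (fun m => ∑ q : Fin a × Fin d, |t q| * (2 * ∑ i, avg fun k =>
        |ecdf (x m) i q.2 (x m l k q.2) - groupCDF μ i q.2 (x m l k q.2)|)) atTop (𝓝 0) := by
      have := tendsto_finsetSum Finset.univ fun (q : Fin a × Fin d) _ =>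
        ((tendsto_finsetSum Finset.univ fun i _ => habs i q.2).const_mul 2).const_mul |t q|
      simpa using this
    refine squeeze_zero (fun m => avg_nonneg fun _ => abs_nonneg _) (fun m => ?_) hlim
    simp_rw [← avg_sum, ← avg_const_mul, ← avg_sum]
    refine avg_mono fun k => ?_
    rw [scoreComb, hu, ← Finset.sum_sub_distrib]
    refine (Finset.abs_sum_le_sum_abs _ _).trans (Finset.sum_le_sum fun q _ => ?_)
    rw [← mul_sub, abs_mul]
    exact mul_le_mul_of_nonneg_left (abs_score_sub_score_le _ _ _ _ _) (abs_nonneg _)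
  have hmean' : Tendsto (fun m => avg (scoreComb t (x m) l)) atTop (𝓝 (∫ y, u y ∂(μ l))) := by
    have h0 : Tendsto (fun m => avg (scoreComb t (x m) l) - avg fun k => u (x m l k)) atTop
        (𝓝 0) := by
      refine squeeze_zero_norm (fun m => ?_) hdiff
      rw [← avg_sub]
      exact abs_avg_le_avg_abs _
    simpa using h0.add hmean
  have hsq' : Tendsto (fun m => avg fun k => scoreComb t (x m) l k ^ 2) atTop
      (𝓝 (∫ y, u y ^ 2 ∂(μ l))) := by
    have h0 : Tendsto (fun m => (avg fun k => scoreComb t (x m) l k ^ 2) -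
        avg fun k => u (x m l k) ^ 2) atTop (𝓝 0) := by
      -- A difference of squares is the difference times the sum, and the sum is at most `2 * B`.
      have hlim := hdiff.const_mul (2 * B)
      rw [mul_zero] at hlim
      refine squeeze_zero_norm (fun m => ?_) hlim
      rw [← avg_sub, ← avg_const_mul]
      refine (abs_avg_le_avg_abs _).trans (avg_mono fun k => ?_)
      rw [sq_sub_sq, abs_mul]
      refine mul_le_mul_of_nonneg_right ?_ (abs_nonneg _)
      refine (abs_add_le _ _).trans ?_
      linarith [hsB m k, huB (x m l k)]
    simpa using h0.add hsq
  rw [variance_eq_sub (memLp_two_of_bound hum huB)]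
  exact hsq'.sub (hmean'.pow 2)

/-- Convergence of the characteristic functions of the bootstrap effects. -/
theorem EmpiricalLimit.tendsto_charFun (hx : EmpiricalLimit μ x) {lam : Fin a → ℝ}
    (hN : Tendsto (fun m => ∑ i, n m i) atTop atTop) (hlam : ∀ i, 0 < lam i)
    (hfrac : ∀ i, Tendsto (fun m => (n m i : ℝ) / ((∑ l, n m l : ℕ) : ℝ)) atTop (𝓝 (lam i)))
    (t : Fin a × Fin d → ℝ) :
    Tendsto (fun m => ∫ κ, Complex.exp (((√((∑ l, n m l : ℕ) : ℝ) *
        ∑ q, t q * (estEffect (resample (x m) κ) - estEffect (x m)) q : ℝ) : ℂ) * Complex.I)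
          ∂(drawLaw (n m)))
      atTop (𝓝 (Complex.exp ((-(t ⬝ᵥ (asympCov μ lam *ᵥ t)) / 2 : ℝ) : ℂ))) := by
  have hn := tendsto_sampleSize hN hlam hfrac
  have hr := tendsto_total_div_sampleSize hlam hfrac
  set N : ℕ → ℝ := fun m => ((∑ l, n m l : ℕ) : ℝ) with hNdef
  have hpos : ∀ᶠ m in atTop, ∀ i, 0 < n m i :=
    eventually_all.2 fun i => (hn i).eventually_gt_atTop 0
  have hlin : Tendsto (fun m => ∫ κ, Complex.exp (((√(N m) *
      ∑ l, bootDev (κ l) (scoreComb t (x m) l) : ℝ) : ℂ) * Complex.I) ∂(drawLaw (n m)))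
      atTop (𝓝 (Complex.exp ((-(t ⬝ᵥ (asympCov μ lam *ᵥ t)) / 2 : ℝ) : ℂ))) := by
    -- The groups are resampled independently, so characteristic functions multiply and the
    -- exponents add up to the quadratic form of `asympCov`.
    have hprod := tendsto_finsetProd Finset.univ fun (l : Fin a) _ =>
      tendsto_integral_exp_bootDev (hn l) (s := fun m => √(N m)) (r := (lam l)⁻¹)
        (by simpa only [Real.sq_sqrt (Nat.cast_nonneg _), hNdef] using hr l)
        (fun m => scoreComb t (x m) l) (B := ∑ q, |t q|)
        (fun m k => abs_sum_mul_le t fun q =>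
          abs_score_le_one (ecdf_nonneg _) (ecdf_le_one _) l q _)
        (hx.tendsto_variance_scoreComb t l)
    rw [← Complex.exp_sum, ← Complex.ofReal_sum] at hprod
    have e : ∑ l, -((lam l)⁻¹ * Var[fun y => ∑ q, t q * score (groupCDF μ) l q y; μ l] / 2) =
        -(t ⬝ᵥ (asympCov μ lam *ᵥ t)) / 2 := by
      rw [dotProduct_asympCov_mulVec, Finset.sum_neg_distrib, ← Finset.sum_div, neg_div]
    rw [e] at hprod
    refine hprod.congr fun m => ?_
    have h : ∀ κ : (i : Fin a) → Fin (n m i) → Fin (n m i),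
        Complex.exp (((√(N m) * ∑ l, bootDev (κ l) (scoreComb t (x m) l) : ℝ) : ℂ) * Complex.I) =
        ∏ l, Complex.exp (((√(N m) * bootDev (κ l) (scoreComb t (x m) l) : ℝ) : ℂ) *
          Complex.I) := by
      intro κ
      rw [← Complex.exp_sum, ← Finset.sum_mul, Finset.mul_sum, Complex.ofReal_sum]
    simp_rw [h]
    unfold drawLaw
    rw [integral_fintype_prod_eq_prod (f := fun (l : Fin a) (κ : Fin (n m l) → Fin (n m l)) =>
      Complex.exp (((√(N m) * bootDev κ (scoreComb t (x m) l) : ℝ) : ℂ) * Complex.I))]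
  -- √N times the mean absolute bilinear term is at most √(N / (n_i n_l)), which tends to zero as N
  -- / n_i converges and n_l grows.
  have hrem : Tendsto (fun m => ∑ q : Fin a × Fin d, |t q| * ((a : ℝ)⁻¹ * ∑ l : Fin a,
      √(N m / n m q.1 * (n m l : ℝ)⁻¹))) atTop (𝓝 0) := by
    have h0 : ∀ i l : Fin a, Tendsto (fun m => √(N m / n m i * (n m l : ℝ)⁻¹)) atTop (𝓝 0) := by
      intro i l
      have := ((hr i).mul ((tendsto_inv_atTop_nhds_zero_nat (𝕜 := ℝ)).comp (hn l))).sqrt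
      rwa [mul_zero, Real.sqrt_zero] at this
    have := tendsto_finsetSum Finset.univ fun (q : Fin a × Fin d) _ =>
      ((tendsto_finsetSum Finset.univ fun l _ => h0 q.1 l).const_mul (a : ℝ)⁻¹).const_mul |t q|
    simpa using this
  have hdiff : Tendsto (fun m => (∫ κ, Complex.exp (((√(N m) *
        ∑ q, t q * (estEffect (resample (x m) κ) - estEffect (x m)) q : ℝ) : ℂ) * Complex.I)
          ∂(drawLaw (n m))) - ∫ κ, Complex.exp (((√(N m) *
      ∑ l, bootDev (κ l) (scoreComb t (x m) l) : ℝ) : ℂ) * Complex.I) ∂(drawLaw (n m)))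
      atTop (𝓝 0) := by
    refine squeeze_zero_norm' ?_ hrem
    filter_upwards [hpos] with m hm
    rw [← integral_sub .of_finite .of_finite]
    refine (norm_integral_le_integral_norm _).trans ?_
    calc _ ≤ ∫ κ, ∑ q : Fin a × Fin d, |t q| * ((a : ℝ)⁻¹ * ∑ l : Fin a,
          √(N m) * |bootRem (x m) κ q.1 q.2 l|) ∂(drawLaw (n m)) := by
          refine integral_mono .of_finite .of_finite fun κ => ?_
          dsimp only
          rw [sum_mul_estEffect_resample_sub hm]
          set A := √(N m) * ∑ l, bootDev (κ l) (scoreComb t (x m) l)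
          set R := √(N m) * ∑ q, t q * ((a : ℝ)⁻¹ * ∑ l, bootRem (x m) κ q.1 q.2 l) with hR
          have h1 : ‖Complex.exp (((A + R : ℝ) : ℂ) * Complex.I) -
              Complex.exp ((A : ℂ) * Complex.I)‖ ≤ |R| := by
            have : Complex.exp (((A + R : ℝ) : ℂ) * Complex.I) - Complex.exp ((A : ℂ) * Complex.I)
                = Complex.exp ((A : ℂ) * Complex.I) * (Complex.exp (Complex.I * R) - 1) := by
              rw [mul_sub, ← Complex.exp_add, mul_one]
              push_cast
              ring_nf
            rw [this, norm_mul, Complex.norm_exp_ofReal_mul_I, one_mul]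
            exact Real.norm_exp_I_mul_ofReal_sub_one_le
          rw [mul_add]
          refine h1.trans ?_
          rw [hR, Finset.mul_sum]
          refine (Finset.abs_sum_le_sum_abs _ _).trans (Finset.sum_le_sum fun q _ => ?_)
          rw [abs_mul, abs_mul, abs_mul, abs_of_nonneg (Real.sqrt_nonneg _),
            abs_of_nonneg (inv_nonneg.2 (Nat.cast_nonneg (α := ℝ) a)), ← Finset.mul_sum]
          have := Finset.abs_sum_le_sum_abs (fun l => bootRem (x m) κ q.1 q.2 l) Finset.univ
          calc _ = |t q| * ((a : ℝ)⁻¹ * (√(N m) * |∑ l, bootRem (x m) κ q.1 q.2 l|)) := by ring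
            _ ≤ _ := by gcongr
      _ = ∑ q : Fin a × Fin d, |t q| * ((a : ℝ)⁻¹ * ∑ l : Fin a,
          √(N m) * ∫ κ, |bootRem (x m) κ q.1 q.2 l| ∂(drawLaw (n m))) := by
          rw [integral_finsetSum _ fun _ _ => .of_finite]
          refine Finset.sum_congr rfl fun q _ => ?_
          rw [integral_const_mul, integral_const_mul, integral_finsetSum _ fun _ _ => .of_finite]
          simp_rw [integral_const_mul]
      _ ≤ _ := by
          gcongr with q _ l
          refine (mul_le_mul_of_nonneg_left (integral_abs_bootRem_le _ _ _ _)
            (Real.sqrt_nonneg _)).trans_eq ?_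
          rw [← Real.sqrt_mul (Nat.cast_nonneg _), div_eq_mul_inv, mul_assoc]
  have := hdiff.add hlin
  rw [zero_add] at this
  exact this.congr fun m => sub_add_cancel _ _

/-- The bootstrap law of the ANOVA-type statistic converges along sequences of samples. -/
theorem EmpiricalLimit.tendsto_blDist (hx : EmpiricalLimit μ x) {lam : Fin a → ℝ}
    (hN : Tendsto (fun m => ∑ i, n m i) atTop atTop) (hlam : ∀ i, 0 < lam i)
    (hfrac : ∀ i, Tendsto (fun m => (n m i : ℝ) / ((∑ l, n m l : ℕ) : ℝ)) atTop (𝓝 (lam i)))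
    (T : Matrix (Fin a × Fin d) (Fin a × Fin d) ℝ) :
    Tendsto (fun m => blDist (bootATSLaw T (x m)) (gaussianFormLaw (asympCov μ lam) T)) atTop
      (𝓝 0) := by
  let E := EuclideanSpace ℝ (Fin a × Fin d)
  let S : (m : ℕ) → ((i : Fin a) → Fin (n m i) → Fin (n m i)) → E := fun m κ =>
    WithLp.toLp 2 (√((∑ l, n m l : ℕ) : ℝ) • (estEffect (resample (x m) κ) - estEffect (x m)))
  have hSm : ∀ m, Measurable (S m) := fun m => measurable_of_finite _
  let L : ℕ → ProbabilityMeasure E := fun m =>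
    ⟨(drawLaw (n m)).map (S m), Measure.isProbabilityMeasure_map (hSm m).aemeasurable⟩
  let G : ProbabilityMeasure E := ⟨multivariateGaussian 0 (asympCov μ lam), inferInstance⟩
  -- The formula for the characteristic function of `multivariateGaussian` is applied with this
  -- positivity.
  have hpsd : (asympCov μ lam).PosSemidef := asympCov_posSemidef μ fun i => (hlam i).le
  have hL : Tendsto L atTop (𝓝 G) := by
    refine ProbabilityMeasure.tendsto_iff_tendsto_charFun.2 fun t => ?_
    have hG : charFun (G : Measure E) t =
        Complex.exp ((-(t.ofLp ⬝ᵥ (asympCov μ lam *ᵥ t.ofLp)) / 2 : ℝ) : ℂ) := by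
      change charFun (multivariateGaussian 0 (asympCov μ lam)) t = _
      rw [charFun_multivariateGaussian hpsd]
      congr 1
      simp [neg_div]
    rw [hG]
    refine (hx.tendsto_charFun hN hlam hfrac t.ofLp).congr fun m => ?_
    change _ = charFun ((drawLaw (n m)).map (S m)) t
    rw [charFun_apply, integral_map (hSm m).aemeasurable (by fun_prop)]
    congr 1
    funext κ
    congr 3
    rw [Finset.mul_sum, PiLp.inner_apply]
    refine Finset.sum_congr rfl fun q _ => ?_
    simp [S]
    ring
  have hq : Continuous fun z : EuclideanSpace ℝ (Fin a × Fin d) => z.ofLp ⬝ᵥ (T *ᵥ z.ofLp) := by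
    simp only [dotProduct, mulVec]
    fun_prop
  have hmap := ((ProbabilityMeasure.continuous_map hq).tendsto G).comp hL
  refine (MultiRank.tendsto_blDist hmap).congr fun m => ?_
  have e1 : ((L m).map hq.aemeasurable : Measure ℝ) = bootATSLaw T (x m) := by
    change ((drawLaw (n m)).map (S m)).map _ = _
    rw [Measure.map_map hq.measurable (hSm m), bootATSLaw]
    congr 1
    funext κ
    simp only [Function.comp, S, bootATS, mulVec_smul, smul_dotProduct, dotProduct_smul,
      smul_eq_mul]
    rw [← mul_assoc, Real.mul_self_sqrt (Nat.cast_nonneg _)]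
  change blDist ((L m).map hq.aemeasurable : Measure ℝ) _ = _
  rw [e1]
  rfl

end

end

/-! ### Moment bounds for the empirical quantities -/

section Moments

variable {Ω : Type*} [MeasurableSpace Ω] {P : Measure Ω} [IsProbabilityMeasure P] {a d : ℕ}
  {X : Fin a → ℕ → Ω → (Fin d → ℝ)} {μ : Fin a → Measure (Fin d → ℝ)}

theorem isProbabilityMeasure_of_map_eq (hmeas : ∀ i k, Measurable (X i k))
    (hlaw : ∀ i k, P.map (X i k) = μ i) (i : Fin a) : IsProbabilityMeasure (μ i) := by
  rw [← hlaw i 0]; exact Measure.isProbabilityMeasure_map (hmeas i 0).aemeasurable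

/-- Averages of a kernel that is centred in its second argument have second moment of the order
of the inverse sample size, even if the first argument is one of the observations. -/
theorem integral_avg_kernel_sq_le (hmeas : ∀ i k, Measurable (X i k))
    (hlaw : ∀ i k, P.map (X i k) = μ i)
    (hindep : iIndepFun (fun q : Fin a × ℕ => X q.1 q.2) P)
    (l : Fin a) (k : ℕ) (i : Fin a) {h : (Fin d → ℝ) → (Fin d → ℝ) → ℝ}
    (hh : Measurable (Function.uncurry h)) {B : ℝ} (hB : ∀ y z, |h y z| ≤ B)
    (h0 : ∀ y, ∫ z, h y z ∂(μ i) = 0) (n : ℕ) :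
    ∫ ω, (avg fun r : Fin n => h (X l k ω) (X i r ω)) ^ 2 ∂P ≤ 2 * B ^ 2 / n := by
  classical
  rcases Nat.eq_zero_or_pos n with hn | hn
  · subst hn; simp [avg]
  have hn' : (0 : ℝ) < n := by positivity
  have hprobi := isProbabilityMeasure_of_map_eq hmeas hlaw i
  have hXm : ∀ r, Measurable fun ω => h (X l k ω) (X i r ω) := fun r =>
    hh.comp ((hmeas l k).prodMk (hmeas i r))
  have hle : ∀ y z w, |h y z * h y w| ≤ B ^ 2 := fun y z w => by
    rw [abs_mul, sq]
    exact mul_le_mul (hB _ _) (hB _ _) (abs_nonneg _) ((abs_nonneg _).trans (hB y z))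
  have hint : ∀ r s, Integrable (fun ω => h (X l k ω) (X i r ω) * h (X l k ω) (X i s ω)) P :=
    fun r s => integrable_of_bound ((hXm r).mul (hXm s)) fun ω => hle _ _ _
  -- Here `X i s` is independent of the pair `(X l k, X i r)`, even if the two members of that pair
  -- coincide; integrating it out first gives zero by centring.
  have horth : ∀ r s : ℕ, (i, s) ≠ (l, k) → s ≠ r →
      ∫ ω, h (X l k ω) (X i r ω) * h (X l k ω) (X i s ω) ∂P = 0 := by
    intro r s hs hsr
    have hind := hindep.indepFun_prodMk (fun q => hmeas q.1 q.2) (l, k) (i, r) (i, s) hs.symm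
      (fun e => hsr (Prod.ext_iff.1 e).2.symm)
    have hU : Measurable fun ω => (X l k ω, X i r ω) := (hmeas l k).prodMk (hmeas i r)
    have hmap := hind.map_prod_eq_prod_map_map hU.aemeasurable (hmeas i s).aemeasurable
    have hprobU : IsProbabilityMeasure (P.map fun ω => (X l k ω, X i r ω)) :=
      Measure.isProbabilityMeasure_map hU.aemeasurable
    set g : ((Fin d → ℝ) × (Fin d → ℝ)) × (Fin d → ℝ) → ℝ :=
      fun p => h p.1.1 p.1.2 * h p.1.1 p.2 with hg
    have hgm : Measurable g :=
      (hh.comp measurable_fst).mul (hh.comp ((measurable_fst.comp measurable_fst).prodMk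
        measurable_snd))
    have e : ∫ ω, h (X l k ω) (X i r ω) * h (X l k ω) (X i s ω) ∂P =
        ∫ p, g p ∂(P.map fun ω => ((X l k ω, X i r ω), X i s ω)) := by
      rw [integral_map (hU.prodMk (hmeas i s)).aemeasurable hgm.aestronglyMeasurable]
    rw [e, hmap, hlaw i s, integral_prod _ (integrable_of_bound hgm fun p => hle _ _ _)]
    simp only [hg, integral_const_mul, h0, mul_zero, integral_zero]
  -- Only `s = r` and `(i, s) = (l, k)` survive: at most `2 * n` of the `n ^ 2` pairs, each
  -- contributing at most `B ^ 2`.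
  have hterm : ∀ r s : Fin n, ∫ ω, h (X l k ω) (X i r ω) * h (X l k ω) (X i s ω) ∂P ≤
      B ^ 2 * ((if s = r then 1 else 0) + (if (i, (s : ℕ)) = (l, k) then 1 else 0)) := by
    intro r s
    have hub : ∫ ω, h (X l k ω) (X i r ω) * h (X l k ω) (X i s ω) ∂P ≤ B ^ 2 := by
      have := integral_mono (hint r s) (integrable_const (B ^ 2)) fun ω =>
        (le_abs_self _).trans (hle (X l k ω) (X i r ω) (X i s ω))
      simpa using this
    have hB2 : 0 ≤ B ^ 2 := sq_nonneg B
    by_cases h1 : s = r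
    · rw [if_pos h1]
      refine hub.trans ?_
      split_ifs <;> nlinarith
    · by_cases h2 : (i, (s : ℕ)) = (l, k)
      · rw [if_pos h2, if_neg h1]
        linarith
      · rw [horth r s h2 fun e => h1 (Fin.ext e), if_neg h1, if_neg h2]
        simp
  have hcard : ∑ s : Fin n, (if (i, (s : ℕ)) = (l, k) then (1 : ℝ) else 0) ≤ 1 := by
    rw [Finset.sum_boole]
    have : (Finset.univ.filter fun s : Fin n => (i, (s : ℕ)) = (l, k)).card ≤ 1 := by
      refine Finset.card_le_one.2 fun s hs s' hs' => ?_
      simp only [Finset.mem_filter, Finset.mem_univ, true_and, Prod.mk.injEq] at hs hs'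
      exact Fin.ext (hs.2.trans hs'.2.symm)
    exact_mod_cast this
  have hexp : ∀ ω, (avg fun r : Fin n => h (X l k ω) (X i r ω)) ^ 2 =
      ((n : ℝ) ^ 2)⁻¹ * ∑ r : Fin n, ∑ s : Fin n,
        h (X l k ω) (X i r ω) * h (X l k ω) (X i s ω) := fun ω => by
    rw [avg, div_pow, sq (∑ r : Fin n, _), Finset.sum_mul_sum, div_eq_inv_mul]
  simp_rw [hexp]
  have hsum : ∫ ω, ∑ r : Fin n, ∑ s : Fin n, h (X l k ω) (X i r ω) * h (X l k ω) (X i s ω) ∂P =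
      ∑ r : Fin n, ∑ s : Fin n, ∫ ω, h (X l k ω) (X i r ω) * h (X l k ω) (X i s ω) ∂P := by
    rw [integral_finsetSum _ fun (r : Fin n) _ => integrable_finsetSum _ fun (s : Fin n) _ =>
      hint r s]
    exact Finset.sum_congr rfl fun r _ => integral_finsetSum _ fun (s : Fin n) _ => hint r s
  rw [integral_const_mul, hsum]
  calc _ ≤ ((n : ℝ) ^ 2)⁻¹ * ∑ r : Fin n, ∑ s : Fin n,
        B ^ 2 * ((if s = r then 1 else 0) + (if (i, (s : ℕ)) = (l, k) then 1 else 0)) := by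
        gcongr with r _ s
        exact hterm r s
    _ ≤ ((n : ℝ) ^ 2)⁻¹ * ∑ _r : Fin n, B ^ 2 * (1 + 1) := by
        gcongr with r
        rw [← Finset.mul_sum, Finset.sum_add_distrib]
        gcongr
        simp
    _ = 2 * B ^ 2 / n := by
        simp
        field_simp
        norm_num

variable (μ) in
/-- The total squared error of the empirical quantities on which the bootstrap law depends. -/
noncomputable def empErr {n : Fin a → ℕ} (x : Sample n d) : ℝ :=
  (∑ l, ∑ i, ∑ j, avg fun k => (ecdf x i j (x l k j) - groupCDF μ i j (x l k j)) ^ 2) +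
  (∑ l, ∑ q, ∑ q', ((avg fun k =>
    score (groupCDF μ) l q (x l k) * score (groupCDF μ) l q' (x l k)) -
      ∫ y, score (groupCDF μ) l q y * score (groupCDF μ) l q' y ∂(μ l)) ^ 2) +
  ∑ l, ∑ q, ((avg fun k => score (groupCDF μ) l q (x l k)) -
      ∫ y, score (groupCDF μ) l q y ∂(μ l)) ^ 2

theorem tendsto_of_sq_sub_tendsto_zero {f : ℕ → ℝ} {r : ℝ}
    (h : Tendsto (fun m => (f m - r) ^ 2) atTop (𝓝 0)) : Tendsto f atTop (𝓝 r) := by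
  have h1 := h.sqrt
  simp only [Real.sqrt_sq_eq_abs, Real.sqrt_zero] at h1
  exact tendsto_sub_nhds_zero_iff.1 ((tendsto_zero_iff_abs_tendsto_zero _).2 h1)

/-- All summands of `empErr` are nonnegative, so each one is dominated by the total. A single scalar
thus controls every convergence required. -/
theorem EmpiricalLimit.of_tendsto_empErr {n : ℕ → Fin a → ℕ} {x : (m : ℕ) → Sample (n m) d}
    (h : Tendsto (fun m => empErr μ (x m)) atTop (𝓝 0)) : EmpiricalLimit μ x := by
  have nn : ∀ m, (0 ≤ ∑ l, ∑ i, ∑ j, avg fun k =>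
        (ecdf (x m) i j (x m l k j) - groupCDF μ i j (x m l k j)) ^ 2) ∧
      (0 ≤ ∑ l, ∑ q, ∑ q', ((avg fun k =>
        score (groupCDF μ) l q (x m l k) * score (groupCDF μ) l q' (x m l k)) -
          ∫ y, score (groupCDF μ) l q y * score (groupCDF μ) l q' y ∂(μ l)) ^ 2) ∧
      0 ≤ ∑ l, ∑ q, ((avg fun k => score (groupCDF μ) l q (x m l k)) -
        ∫ y, score (groupCDF μ) l q y ∂(μ l)) ^ 2 := fun m =>
    ⟨Finset.sum_nonneg fun _ _ => Finset.sum_nonneg fun _ _ => Finset.sum_nonneg fun _ _ =>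
        avg_nonneg fun _ => sq_nonneg _,
      Finset.sum_nonneg fun _ _ => Finset.sum_nonneg fun _ _ => Finset.sum_nonneg fun _ _ =>
        sq_nonneg _,
      Finset.sum_nonneg fun _ _ => Finset.sum_nonneg fun _ _ => sq_nonneg _⟩
  have le3 : ∀ {α β γ : Type} [Fintype α] [Fintype β] [Fintype γ] (f : α → β → γ → ℝ),
      (∀ x y z, 0 ≤ f x y z) → ∀ x y z, f x y z ≤ ∑ x, ∑ y, ∑ z, f x y z := by
    intro α β γ _ _ _ f hf x y z
    calc f x y z ≤ ∑ z, f x y z := Finset.single_le_sum (fun z _ => hf x y z) (Finset.mem_univ z)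
      _ ≤ ∑ y, ∑ z, f x y z := Finset.single_le_sum (f := fun y => ∑ z, f x y z)
          (fun y _ => Finset.sum_nonneg fun z _ => hf x y z) (Finset.mem_univ y)
      _ ≤ _ := Finset.single_le_sum (f := fun x => ∑ y, ∑ z, f x y z)
          (fun x _ => Finset.sum_nonneg fun y _ => Finset.sum_nonneg fun z _ => hf x y z)
          (Finset.mem_univ x)
  refine ⟨fun l i j => ?_, fun l q q' => ?_, fun l q => ?_⟩
  · refine squeeze_zero (fun m => avg_nonneg fun _ => sq_nonneg _) (fun m => ?_) h
    have := le3 (fun l i j => avg fun k =>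
        (ecdf (x m) i j (x m l k j) - groupCDF μ i j (x m l k j)) ^ 2)
      (fun _ _ _ => avg_nonneg fun _ => sq_nonneg _) l i j
    have := nn m
    unfold empErr
    linarith
  · refine tendsto_of_sq_sub_tendsto_zero
      (squeeze_zero (fun m => sq_nonneg _) (fun m => ?_) h)
    have := le3 (fun l q q' => ((avg fun k =>
        score (groupCDF μ) l q (x m l k) * score (groupCDF μ) l q' (x m l k)) -
          ∫ y, score (groupCDF μ) l q y * score (groupCDF μ) l q' y ∂(μ l)) ^ 2)
      (fun _ _ _ => sq_nonneg _) l q q'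
    have := nn m
    unfold empErr
    linarith
  · refine tendsto_of_sq_sub_tendsto_zero
      (squeeze_zero (fun m => sq_nonneg _) (fun m => ?_) h)
    -- A dummy index lets the triple-sum bound serve for a double sum.
    have := le3 (fun l q (_ : Unit) => ((avg fun k => score (groupCDF μ) l q (x m l k)) -
        ∫ y, score (groupCDF μ) l q y ∂(μ l)) ^ 2) (fun _ _ _ => sq_nonneg _) l q ()
    simp only [Finset.univ_unique, Finset.sum_singleton] at this
    have := nn m
    unfold empErr
    linarith

theorem measurable_avg {α : Type*} [MeasurableSpace α] {n : ℕ} {f : Fin n → α → ℝ}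
    (hf : ∀ k, Measurable (f k)) : Measurable fun ω => avg fun k => f k ω := by
  unfold avg
  fun_prop

/-- A quantitative weak law of large numbers for bounded functions. -/
theorem integral_avg_sub_integral_sq_le (hmeas : ∀ i k, Measurable (X i k))
    (hlaw : ∀ i k, P.map (X i k) = μ i) (hindep : iIndepFun (fun q : Fin a × ℕ => X q.1 q.2) P)
    (l : Fin a) {g : (Fin d → ℝ) → ℝ} (hg : Measurable g) (hg1 : ∀ y, |g y| ≤ 1) {n : ℕ}
    (hn : 0 < n) :
    ∫ ω, ((avg fun k : Fin n => g (X l k ω)) - ∫ y, g y ∂(μ l)) ^ 2 ∂P ≤ 8 / n := by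
  have hprob := isProbabilityMeasure_of_map_eq hmeas hlaw l
  have hI : |∫ y, g y ∂(μ l)| ≤ 1 := by
    simpa using norm_integral_le_of_norm_le_const (μ := μ l) (f := g) (C := 1)
      (Eventually.of_forall fun y => by simpa using hg1 y)
  -- The kernel ignores its first argument, so the index 0 is arbitrary; `B = 2` yields 2 · 2² = 8.
  have h := integral_avg_kernel_sq_le hmeas hlaw hindep l 0 l
    (h := fun _ z => g z - ∫ y, g y ∂(μ l)) ((hg.comp measurable_snd).sub_const _) (B := 2)
    (fun _ z => (abs_sub _ _).trans (by linarith [hg1 z]))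
    (fun _ => by rw [integral_sub (integrable_of_bound hg hg1) (integrable_const _)]; simp) n
  simp only [avg_sub, avg_const hn] at h
  exact h.trans_eq (by norm_num)

theorem abs_ecdf_sub_groupCDF_le [∀ i, IsProbabilityMeasure (μ i)] {n : Fin a → ℕ}
    (x : Sample n d) (i : Fin a) (j : Fin d) (t : ℝ) : |ecdf x i j t - groupCDF μ i j t| ≤ 1 :=
  abs_le.2 ⟨by linarith [ecdf_nonneg x i j t, groupCDF_le_one μ i j t],
    by linarith [ecdf_le_one x i j t, groupCDF_nonneg μ i j t]⟩

theorem measurable_ecdf_sub_sq [∀ i, IsProbabilityMeasure (μ i)]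
    (hmeas : ∀ i k, Measurable (X i k)) {n : Fin a → ℕ} (l i : Fin a) (j : Fin d) (k : ℕ) :
    Measurable fun ω => (ecdf (n := n) (fun i k => X i k ω) i j (X l k ω j) -
      groupCDF μ i j (X l k ω j)) ^ 2 := by
  have hX : ∀ i k, Measurable fun ω => X i k ω j := fun i k =>
    (measurable_pi_apply j).comp (hmeas i k)
  refine Measurable.pow_const (Measurable.sub ?_ ((measurable_groupCDF μ i j).comp (hX l k))) 2
  exact measurable_avg fun r => measurable_c.comp ((hX l k).sub (hX i r))

/-- The kernel c(y_j - z_j) - F_ij(y_j) is centred in z. The evaluation point may itself belong to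
the sample defining the empirical distribution function, which is why the kernel bound allows such
an overlap. -/
theorem integral_ecdf_sub_sq_le (hmeas : ∀ i k, Measurable (X i k))
    (hlaw : ∀ i k, P.map (X i k) = μ i) (hindep : iIndepFun (fun q : Fin a × ℕ => X q.1 q.2) P)
    {n : Fin a → ℕ} (l i : Fin a) (j : Fin d) (k : ℕ) (hn : 0 < n i) :
    ∫ ω, (ecdf (n := n) (fun i k => X i k ω) i j (X l k ω j) -
      groupCDF μ i j (X l k ω j)) ^ 2 ∂P ≤ 2 / n i := by
  have hprob := isProbabilityMeasure_of_map_eq hmeas hlaw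
  have h := integral_avg_kernel_sq_le hmeas hlaw hindep l k i
    (h := fun y z => c (y j - z j) - groupCDF μ i j (y j)) (B := 1) ?_ ?_ ?_ (n i)
  · simp only [avg_sub, avg_const hn] at h
    exact h.trans_eq (by norm_num)
  · have hc := measurable_c
    simp only [Function.uncurry_def]
    fun_prop
  · intro y z
    exact abs_le.2 ⟨by linarith [c_nonneg (y j - z j), groupCDF_le_one μ i j (y j)],
      by linarith [c_le_one (y j - z j), groupCDF_nonneg μ i j (y j)]⟩
  · intro y
    have hm : Measurable fun z : Fin d → ℝ => c (y j - z j) := measurable_c.comp (by fun_prop)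
    rw [integral_sub (integrable_of_bound hm fun _ => abs_c_le_one _) (integrable_const _),
      integral_c_sub_apply]
    simp

theorem integrable_avg {α : Type*} [MeasurableSpace α] {ρ : Measure α} {n : ℕ}
    {f : Fin n → α → ℝ} (hf : ∀ k, Integrable (f k) ρ) : Integrable (fun ω => avg fun k => f k ω) ρ :=
  (integrable_finsetSum _ fun k _ => hf k).div_const _

theorem integral_avg {α : Type*} [MeasurableSpace α] {ρ : Measure α} {n : ℕ}
    {f : Fin n → α → ℝ} (hf : ∀ k, Integrable (f k) ρ) :
    ∫ ω, (avg fun k => f k ω) ∂ρ = avg fun k => ∫ ω, f k ω ∂ρ := by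
  simp only [avg]
  rw [integral_div, integral_finsetSum _ fun k _ => hf k]

theorem integrable_avg_sub_sq (hmeas : ∀ i k, Measurable (X i k)) (l : Fin a)
    {g : (Fin d → ℝ) → ℝ} (hg : Measurable g) (hg1 : ∀ y, |g y| ≤ 1) (n : ℕ) (r : ℝ) :
    Integrable (fun ω => ((avg fun k : Fin n => g (X l k ω)) - r) ^ 2) P := by
  refine integrable_of_bound (B := (1 + |r|) ^ 2)
    (((measurable_avg fun k => hg.comp (hmeas l k)).sub_const r).pow_const 2) fun ω => ?_
  rw [abs_pow]
  gcongr
  refine (abs_sub _ _).trans ?_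
  gcongr
  exact abs_avg_le zero_le_one fun k => hg1 _

theorem abs_score_mul_score_le_one [∀ i, IsProbabilityMeasure (μ i)] (l : Fin a)
    (q q' : Fin a × Fin d) (y : Fin d → ℝ) :
    |score (groupCDF μ) l q y * score (groupCDF μ) l q' y| ≤ 1 := by
  rw [abs_mul]
  exact mul_le_one₀ (abs_score_groupCDF_le_one μ l q y) (abs_nonneg _)
    (abs_score_groupCDF_le_one μ l q' y)

/-- The total squared error is integrable and tends to zero in mean. -/
theorem tendsto_integral_empErr (hmeas : ∀ i k, Measurable (X i k))
    (hlaw : ∀ i k, P.map (X i k) = μ i) (hindep : iIndepFun (fun q : Fin a × ℕ => X q.1 q.2) P)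
    {n : ℕ → Fin a → ℕ} (hn : ∀ i, Tendsto (fun m => n m i) atTop atTop) :
    (∀ m, Integrable (fun ω => empErr μ (n := n m) fun i k => X i k ω) P) ∧
    Tendsto (fun m => ∫ ω, empErr μ (n := n m) (fun i k => X i k ω) ∂P) atTop (𝓝 0) := by
  have hprob := isProbabilityMeasure_of_map_eq hmeas hlaw
  have hpos : ∀ᶠ m in atTop, ∀ i, 0 < n m i :=
    eventually_all.2 fun i => (hn i).eventually_gt_atTop 0
  have hlim : ∀ (C : ℝ) i, Tendsto (fun m => C / n m i) atTop (𝓝 0) := fun C i =>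
    (tendsto_const_div_atTop_nhds_zero_nat C).comp (hn i)
  have i0 : ∀ m l i j (k : Fin (n m l)), Integrable (fun ω =>
      (ecdf (n := n m) (fun i k => X i k ω) i j (X l k ω j) -
        groupCDF μ i j (X l k ω j)) ^ 2) P := fun m l i j k =>
    integrable_of_bound (B := 1) (measurable_ecdf_sub_sq hmeas l i j k) fun ω => by
      rw [abs_pow]
      exact pow_le_one₀ (abs_nonneg _) (abs_ecdf_sub_groupCDF_le _ _ _ _)
  have i1 : ∀ m l i j, Integrable (fun ω => avg fun k : Fin (n m l) =>
      (ecdf (n := n m) (fun i k => X i k ω) i j (X l k ω j) -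
        groupCDF μ i j (X l k ω j)) ^ 2) P := fun m l i j => integrable_avg fun k => i0 m l i j k
  have i2 : ∀ m l q q', Integrable (fun ω => ((avg fun k : Fin (n m l) =>
      score (groupCDF μ) l q (X l k ω) * score (groupCDF μ) l q' (X l k ω)) -
        ∫ y, score (groupCDF μ) l q y * score (groupCDF μ) l q' y ∂(μ l)) ^ 2) P :=
    fun m l q q' => integrable_avg_sub_sq hmeas l
      (g := fun y => score (groupCDF μ) l q y * score (groupCDF μ) l q' y) (by fun_prop)
      (abs_score_mul_score_le_one l q q') _ _
  have i3 : ∀ m l q, Integrable (fun ω => ((avg fun k : Fin (n m l) =>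
      score (groupCDF μ) l q (X l k ω)) - ∫ y, score (groupCDF μ) l q y ∂(μ l)) ^ 2) P :=
    fun m l q => integrable_avg_sub_sq hmeas l (by fun_prop) (abs_score_groupCDF_le_one μ l q) _ _
  have t1 : ∀ l i j, Tendsto (fun m => ∫ ω, (avg fun k : Fin (n m l) =>
      (ecdf (n := n m) (fun i k => X i k ω) i j (X l k ω j) -
        groupCDF μ i j (X l k ω j)) ^ 2) ∂P) atTop (𝓝 0) := by
    intro l i j
    refine squeeze_zero' (Eventually.of_forall fun m => integral_nonneg fun ω =>
      avg_nonneg fun _ => sq_nonneg _) ?_ (hlim 2 i)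
    filter_upwards [hpos] with m hm
    rw [integral_avg fun k => i0 m l i j k]
    exact avg_le_of_le (by positivity) fun k =>
      integral_ecdf_sub_sq_le hmeas hlaw hindep l i j k (hm i)
  have t2 : ∀ l q q', Tendsto (fun m => ∫ ω, ((avg fun k : Fin (n m l) =>
      score (groupCDF μ) l q (X l k ω) * score (groupCDF μ) l q' (X l k ω)) -
        ∫ y, score (groupCDF μ) l q y * score (groupCDF μ) l q' y ∂(μ l)) ^ 2 ∂P)
      atTop (𝓝 0) := by
    intro l q q'
    refine squeeze_zero' (Eventually.of_forall fun m => integral_nonneg fun ω => sq_nonneg _) ?_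
      (hlim 8 l)
    filter_upwards [hpos] with m hm
    exact integral_avg_sub_integral_sq_le hmeas hlaw hindep l
      (g := fun y => score (groupCDF μ) l q y * score (groupCDF μ) l q' y) (by fun_prop)
      (abs_score_mul_score_le_one l q q') (hm l)
  have t3 : ∀ l q, Tendsto (fun m => ∫ ω, ((avg fun k : Fin (n m l) =>
      score (groupCDF μ) l q (X l k ω)) - ∫ y, score (groupCDF μ) l q y ∂(μ l)) ^ 2 ∂P)
      atTop (𝓝 0) := by
    intro l q
    refine squeeze_zero' (Eventually.of_forall fun m => integral_nonneg fun ω => sq_nonneg _) ?_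
      (hlim 8 l)
    filter_upwards [hpos] with m hm
    exact integral_avg_sub_integral_sq_le hmeas hlaw hindep l (by fun_prop)
      (abs_score_groupCDF_le_one μ l q) (hm l)
  have s1 := fun m => integrable_finsetSum (μ := P) Finset.univ fun l _ =>
    integrable_finsetSum Finset.univ fun i _ => integrable_finsetSum Finset.univ fun j _ =>
      i1 m l i j
  have s2 := fun m => integrable_finsetSum (μ := P) Finset.univ fun l _ =>
    integrable_finsetSum Finset.univ fun q _ => integrable_finsetSum Finset.univ fun q' _ =>
      i2 m l q q'
  have s3 := fun m => integrable_finsetSum (μ := P) Finset.univ fun l _ =>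
    integrable_finsetSum Finset.univ fun q _ => i3 m l q
  refine ⟨fun m => ((s1 m).add (s2 m)).add (s3 m), ?_⟩
  have hsum : ∀ m, ∫ ω, empErr μ (n := n m) (fun i k => X i k ω) ∂P = _ := fun m =>
    (integral_add ((s1 m).add (s2 m)) (s3 m)).trans
      (congrArg (· + _) (integral_add (s1 m) (s2 m)))
  simp_rw [hsum]
  have r1 := tendsto_finsetSum Finset.univ fun l _ => tendsto_finsetSum Finset.univ fun i _ =>
    tendsto_finsetSum Finset.univ fun j _ => t1 l i j
  have r2 := tendsto_finsetSum Finset.univ fun l _ => tendsto_finsetSum Finset.univ fun q _ =>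
    tendsto_finsetSum Finset.univ fun q' _ => t2 l q q'
  have r3 := tendsto_finsetSum Finset.univ fun l _ => tendsto_finsetSum Finset.univ fun q _ =>
    t3 l q
  have r := (r1.add r2).add r3
  simp only [Finset.sum_const_zero, add_zero] at r
  refine r.congr fun m => ?_
  congr 1
  · congr 1
    · rw [integral_finsetSum _ fun l _ => integrable_finsetSum _ fun i _ =>
        integrable_finsetSum _ fun j _ => i1 m l i j]
      refine Finset.sum_congr rfl fun l _ => ?_
      rw [integral_finsetSum _ fun i _ => integrable_finsetSum _ fun j _ => i1 m l i j]
      refine Finset.sum_congr rfl fun i _ => ?_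
      rw [integral_finsetSum _ fun j _ => i1 m l i j]
    · rw [integral_finsetSum _ fun l _ => integrable_finsetSum _ fun q _ =>
        integrable_finsetSum _ fun q' _ => i2 m l q q']
      refine Finset.sum_congr rfl fun l _ => ?_
      rw [integral_finsetSum _ fun q _ => integrable_finsetSum _ fun q' _ => i2 m l q q']
      refine Finset.sum_congr rfl fun q _ => ?_
      rw [integral_finsetSum _ fun q' _ => i2 m l q q']
  · rw [integral_finsetSum _ fun l _ => integrable_finsetSum _ fun q _ => i3 m l q]
    refine Finset.sum_congr rfl fun l _ => ?_
    rw [integral_finsetSum _ fun q _ => i3 m l q]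

end Moments

/-! ### From small empirical error to convergence in outer probability. -/

theorem empErr_nonneg {a d : ℕ} {n : Fin a → ℕ} (μ : Fin a → Measure (Fin d → ℝ))
    (x : Sample n d) : 0 ≤ empErr μ x :=
  add_nonneg (add_nonneg
    (Finset.sum_nonneg fun _ _ => Finset.sum_nonneg fun _ _ => Finset.sum_nonneg fun _ _ =>
        avg_nonneg fun _ => sq_nonneg _)
    (Finset.sum_nonneg fun _ _ => Finset.sum_nonneg fun _ _ => Finset.sum_nonneg fun _ _ =>
        sq_nonneg _))
    (Finset.sum_nonneg fun _ _ => Finset.sum_nonneg fun _ _ => sq_nonneg _)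

/-- The bootstrap law is uniformly close to its limit for samples with small total squared
error. -/
theorem exists_blDist_le_of_empErr_lt {a d : ℕ} {n : ℕ → Fin a → ℕ}
    {μ : Fin a → Measure (Fin d → ℝ)} [∀ i, IsProbabilityMeasure (μ i)] {lam : Fin a → ℝ}
    (hN : Tendsto (fun m => ∑ i, n m i) atTop atTop) (hlam : ∀ i, 0 < lam i)
    (hfrac : ∀ i, Tendsto (fun m => (n m i : ℝ) / ((∑ l, n m l : ℕ) : ℝ)) atTop (𝓝 (lam i)))
    (T : Matrix (Fin a × Fin d) (Fin a × Fin d) ℝ) {ε : ℝ} (hε : 0 < ε) :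
    ∃ δ > 0, ∀ᶠ m in atTop, ∀ x : Sample (n m) d, empErr μ x < δ →
      blDist (bootATSLaw T x) (gaussianFormLaw (asympCov μ lam) T) ≤ ε := by
  -- If uniformity failed, samples with `empErr` below `1 / (k + 1)` but distance above `ε` could be
  -- chosen at stages `φ k ≥ k`. They form a deterministic sequence to which the sequential limit
  -- theorem applies, a contradiction.
  by_contra! hcon
  have h : ∀ k : ℕ, ∃ m, k ≤ m ∧ ∃ x : Sample (n m) d, empErr μ x < 1 / ((k : ℝ) + 1) ∧
      ε < blDist (bootATSLaw T x) (gaussianFormLaw (asympCov μ lam) T) := by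
    intro k
    have hk := hcon (1 / ((k : ℝ) + 1)) (by positivity)
    obtain ⟨m, hm, x, hx⟩ := (frequently_atTop.1 hk) k
    exact ⟨m, hm, x, hx⟩
  choose φ hφ x hx1 hx2 using h
  have hφ' : Tendsto φ atTop atTop := tendsto_atTop_mono hφ tendsto_id
  have hemp : Tendsto (fun k => empErr μ (x k)) atTop (𝓝 0) :=
    squeeze_zero (fun k => empErr_nonneg μ _) (fun k => (hx1 k).le)
      tendsto_one_div_add_atTop_nhds_zero_nat
  have hlim := (EmpiricalLimit.of_tendsto_empErr (n := fun k => n (φ k)) hemp).tendsto_blDist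
    (hN.comp hφ') hlam (fun i => (hfrac i).comp hφ') T
  exact absurd (ge_of_tendsto' hlim fun k => (hx2 k).le) (not_le.2 hε)

end MultiRank

/-- The observations `X i k` (`k = 0, 1, 2, …`) of group `i` are i.i.d. with law `μ i`; at stage `m`
the first `n m i` of them are observed. No assumption is made on the value of `T p`, so that both
the null hypothesis and the alternative are covered. -/
theorem mainTheorem6 {Ω : Type*} [MeasurableSpace Ω] (P : Measure Ω) [IsProbabilityMeasure P]
    {a d : ℕ} (X : Fin a → ℕ → Ω → (Fin d → ℝ)) (μ : Fin a → Measure (Fin d → ℝ))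
    (hmeas : ∀ i k, Measurable (X i k))
    (hlaw : ∀ i k, P.map (X i k) = μ i)
    (hindep : iIndepFun (fun q : Fin a × ℕ => X q.1 q.2) P)
    (n : ℕ → Fin a → ℕ) (lam : Fin a → ℝ)
    (hN : Tendsto (fun m => ∑ i, n m i) atTop atTop)
    (hlam : ∀ i, lam i ∈ Set.Ioo (0 : ℝ) 1)
    (hfrac : ∀ i, Tendsto (fun m => (n m i : ℝ) / ((∑ l, n m l : ℕ) : ℝ)) atTop (𝓝 (lam i)))
    (T : Matrix (Fin a × Fin d) (Fin a × Fin d) ℝ) (hT : T.IsSymm) (hT' : T * T = T) :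
    (MultiRank.asympCov μ lam).PosSemidef ∧
    (∀ h, 0 ≤ MultiRank.weights (MultiRank.asympCov μ lam) hT h) ∧
    MultiRank.gaussianFormLaw (MultiRank.asympCov μ lam) T =
      MultiRank.weightedChiSqLaw (MultiRank.weights (MultiRank.asympCov μ lam) hT) ∧
    MultiRank.TendstoInOuterProb P
      (fun m ω => MultiRank.bootATSLaw (n := n m) T (fun i k => X i k ω))
      (MultiRank.weightedChiSqLaw (MultiRank.weights (MultiRank.asympCov μ lam) hT)) := by
  have hprob := MultiRank.isProbabilityMeasure_of_map_eq hmeas hlaw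
  have hlam0 : ∀ i, 0 < lam i := fun i => (hlam i).1
  refine ⟨MultiRank.asympCov_posSemidef μ fun i => (hlam0 i).le,
    MultiRank.weights_nonneg _ hT hT', MultiRank.gaussianFormLaw_eq_weightedChiSqLaw _ hT, ?_⟩
  rw [← MultiRank.gaussianFormLaw_eq_weightedChiSqLaw _ hT]
  intro ε hε
  obtain ⟨δ, hδ, hev⟩ :=
    MultiRank.exists_blDist_le_of_empErr_lt (μ := μ) hN hlam0 hfrac T hε
  obtain ⟨hint, hlim⟩ := MultiRank.tendsto_integral_empErr hmeas hlaw hindep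
    (MultiRank.tendsto_sampleSize hN hlam0 hfrac)
  have hlim' : Tendsto (fun m => ENNReal.ofReal (δ⁻¹ *
      ∫ ω, MultiRank.empErr μ (n := n m) (fun i k => X i k ω) ∂P)) atTop (𝓝 0) := by
    have := ENNReal.tendsto_ofReal (hlim.const_mul δ⁻¹)
    simpa using this
  refine tendsto_of_tendsto_of_tendsto_of_le_of_le' tendsto_const_nhds hlim'
    (Eventually.of_forall fun m => zero_le) ?_
  filter_upwards [hev] with m hm
  -- Monotonicity of outer measure makes measurability of the bounded Lipschitz distance irrelevant;
  -- Markov's inequality is applied to the integrable `empErr` only.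
  calc _ ≤ P {ω | δ ≤ MultiRank.empErr μ (n := n m) fun i k => X i k ω} := by
        refine measure_mono fun ω hω => ?_
        by_contra hlt
        exact absurd (hm _ (not_le.1 hlt)) (not_le.2 hω)
    _ ≤ _ := by
        rw [← ofReal_measureReal]
        refine ENNReal.ofReal_le_ofReal ?_
        rw [inv_mul_eq_div, le_div_iff₀' hδ]
        exact mul_meas_ge_le_integral_of_nonneg
          (Eventually.of_forall fun ω => MultiRank.empErr_nonneg μ _) (hint m) δ
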